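/- Let $\mathbb R^4$ carry the Minkowski square $\beta^2=(\beta^0)^2-(\beta^1)^2-(\beta^2)^2-(\beta^3)^2$, let $V_+=\{\beta\in\mathbb R^4:\beta^0>0,\ \beta^2>0\}$ be the open forward light cone, and write $\partial^0=\partial/\partial\beta^0$, $\partial^j=-\partial/\partial\beta^j$ for $j=1,2,3$, and $\square=(\partial^0)^2-(\partial^1)^2-(\partial^2)^2-(\partial^3)^2$. For $B\subset V_+$ put $\|\Phi\|_B=\sup_{\beta\in B}|\Phi(\beta)|$. For a multi-index $\boldsymbol\mu=(\mu_1,\dots,\mu_m)$ with $m\ge 0$ and $\mu_i\in\{0,1,2,3\}$, define the thermal function $$\Theta^{\boldsymbol\mu}(\beta)=c_m\,\partial^{\mu_1}\cdots\partial^{\mu_m}\,(\beta^2)^{-1},\qquad \beta\in V_+,$$ where $c_m=0$ if $m$ is odd and $c_m=(-1)^{m/2}(4\pi)^m\,|B_{m+2}|/(m+2)!$ if $m$ is even, $B_n$ being the Bernoulli numbers. For $\nu\in\{0,1,2,3\}$ let $\nu\boldsymbol\mu=(\nu,\mu_1,\dots,\mu_m)$. Let $\Xi$ be a real- or complex-valued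 $C^\infty$ function on $V_+$ with $\square\,\Xi=0$ on $V_+$, let $B\subset V_+$ be compact, and let $\varepsilon>0$. Then there are constants $c_{\boldsymbol\mu}$, $c'_{\boldsymbol\mu}$ (real if $\Xi$ is real-valued, complex in general), only finitely many of them nonzero, such that $$\Big\|\,\Xi-\sum_{\boldsymbol\mu}c_{\boldsymbol\mu}\,\Theta^{\boldsymbol\mu}\Big\|_B<\varepsilon \qquad\text{and}\qquad \Big\|\,\partial^\nu\Xi-\sum_{\boldsymbol\mu}c'_{\boldsymbol\mu}\,\Theta^{\nu\boldsymbol\mu}\Big\|_B<\varepsilon\quad\text{for all }\nu=0,1,2,3.$$ -/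

import Mathlib

open scoped ContDiff ENNReal

noncomputable section

namespace Thermal

/-- Minkowski space `ℝ⁴`; the coordinate `0` is time. -/
abbrev Minkowski : Type := Fin 4 → ℝ

/-- The diagonal entries of the Minkowski metric of signature `(+,-,-,-)`. -/
def eta (μ : Fin 4) : ℝ := if μ = 0 then 1 else -1

/-- The Lorentz square `β² = (β⁰)² - (β¹)² - (β²)² - (β³)²`. -/
def sq (β : Minkowski) : ℝ := ∑ μ, eta μ * β μ ^ 2

/-- The open forward light cone. -/
def forwardCone : Set Minkowski := {β | 0 < β 0 ∧ 0 < sq β}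

section Derivatives

variable {F : Type*} [NormedAddCommGroup F] [NormedSpace ℝ F]

/-- The partial derivative `∂_μ = ∂/∂β^μ`. -/
def partialDown (μ : Fin 4) (f : Minkowski → F) : Minkowski → F :=
  fun β => fderiv ℝ f β (Pi.single μ 1)

/-- The partial derivative with raised index, `∂^μ = ∂/∂β_μ = η^{μμ} ∂_μ`. -/
def partialUp (μ : Fin 4) (f : Minkowski → F) : Minkowski → F :=
  fun β => eta μ • partialDown μ f β

/-- `∂^{μ₁} ⋯ ∂^{μₘ} f` for a multi-index `(μ₁, …, μₘ)`; for `m = 0` this is `f`. -/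
def multiPartialUp (μs : List (Fin 4)) (f : Minkowski → F) : Minkowski → F :=
  μs.foldr partialUp f

/-- The wave operator `□ = ∑_μ ∂_μ ∂^μ`. -/
def box (f : Minkowski → F) : Minkowski → F :=
  fun β => ∑ μ, partialDown μ (partialUp μ f) β

/-- Smooth solutions of the wave equation on the open forward cone. (Values of `Ξ` outside the
cone are irrelevant, since the cone is open.) -/
structure IsSmoothWaveSolution (Ξ : Minkowski → F) : Prop where
  smooth : ContDiffOn ℝ ∞ Ξ forwardCone
  wave : ∀ β ∈ forwardCone, box Ξ β = 0

/-- The seminorm `‖Φ‖_B = sup_{β ∈ B} |Φ(β)|`, with values in `[0, ∞]`. -/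
def seminormOn (B : Set Minkowski) (Φ : Minkowski → F) : ℝ≥0∞ := ⨆ β ∈ B, ‖Φ β‖ₑ

end Derivatives

/-- The constants `c_m`: zero for odd `m`, and `(-1)^{m/2} (4π)^m |B_{m+2}| / (m+2)!` for even
`m`, where `B_n` are the Bernoulli numbers. -/
def thermalConst (m : ℕ) : ℝ :=
  if Even m then
    (-1) ^ (m / 2) * (4 * Real.pi) ^ m * ((m + 2).factorial : ℝ)⁻¹ * |(bernoulli (m + 2) : ℝ)|
  else 0

/-- The thermal functions `Θ^{μ₁…μₘ}(β) = c_m ∂^{μ₁} ⋯ ∂^{μₘ} (β²)⁻¹`. -/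
def thermalFun (μs : List (Fin 4)) : Minkowski → ℝ :=
  fun β => thermalConst μs.length * multiPartialUp μs (fun b => (sq b)⁻¹) β

end Thermal

end

/-! The argument rests on the Kelvin transform `kelvin`, an involution on functions on the forward
cone. It conjugates each partial derivative into a special conformal generator
(`partialDown_kelvin`). The Minkowski square of these generators is `sq y ^ 2` times the wave
operator (`sum_conformalGen_conformalGen`), so solutions go to solutions. For null `n` it turns the
solution `(n · β) ^ k` into `(n · β) ^ k / (β²) ^ (k + 1)`. Up to a nonzero factor this is `(n · ∂)
^ k` applied to `1 / β²` (`exists_mem_derivSpan_eq_pow`). It therefore suffices to approximate the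
transformed solution in `C¹` by sums of `p (n · β)` with `p` a polynomial.

Plane waves `f (n · β)` with smooth `f` are dense (`exists_planeWaves_near`). A real exponential has
the same Cauchy data on a slice `β⁰ = T` as a sum of two plane waves, and exponential sums
approximate the solution and its derivatives up to order two. Kirchhoff's formula on forward light
cones, which never leave the forward cone, carries smallness of the error on the slice back to the
compact set.

Since `n · β > 0` on the cone, the profile `f` matters only on a compact interval of positive
numbers. There even polynomials alone, or odd ones alone, are `C¹`-dense
(`exists_polynomial_near_of_parity`). This freedom is essential because `thermalConst` vanishes at
odd orders: even orders serve the function itself, while odd orders serve its derivatives, where the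
extra index `ν` makes the order even. At even orders the constant is nonzero and can be divided out.
-/

noncomputable section

namespace Thermal

/-! ### Partial derivatives -/

section Partial

variable {F : Type*} [NormedAddCommGroup F] [NormedSpace ℝ F]

lemma eta_mul_self (μ : Fin 4) : eta μ * eta μ = 1 := by
  unfold eta; split_ifs <;> norm_num

lemma abs_eta (μ : Fin 4) : |eta μ| = 1 := by
  unfold eta; split_ifs <;> norm_num

lemma fderiv_apply_eq_sum (f : Minkowski → F) (β v : Minkowski) :
    fderiv ℝ f β v = ∑ μ, v μ • partialDown μ f β := by
  conv_lhs => rw [← Finset.univ_sum_single v, map_sum]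
  refine Finset.sum_congr rfl fun μ _ => ?_
  rw [partialDown, ← map_smul]
  congr 1
  rw [← Pi.single_smul, smul_eq_mul, mul_one]

lemma partialDown_congr {f g : Minkowski → F} {β : Minkowski} (h : f =ᶠ[nhds β] g) (μ : Fin 4) :
    partialDown μ f β = partialDown μ g β := by
  rw [partialDown, partialDown, h.fderiv_eq]

lemma partialDown_add {f g : Minkowski → F} {β : Minkowski} (hf : DifferentiableAt ℝ f β)
    (hg : DifferentiableAt ℝ g β) (μ : Fin 4) :
    partialDown μ (fun b => f b + g b) β = partialDown μ f β + partialDown μ g β := by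
  simp only [partialDown, fderiv_fun_add hf hg, add_apply]

lemma partialDown_sub {f g : Minkowski → F} {β : Minkowski} (hf : DifferentiableAt ℝ f β)
    (hg : DifferentiableAt ℝ g β) (μ : Fin 4) :
    partialDown μ (fun b => f b - g b) β = partialDown μ f β - partialDown μ g β := by
  simp only [partialDown, fderiv_fun_sub hf hg, sub_apply]

lemma partialDown_sum {ι : Type*} (s : Finset ι) {f : ι → Minkowski → F} {β : Minkowski}
    (hf : ∀ i ∈ s, DifferentiableAt ℝ (f i) β) (μ : Fin 4) :
    partialDown μ (fun b => ∑ i ∈ s, f i b) β = ∑ i ∈ s, partialDown μ (f i) β := by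
  simp only [partialDown, fderiv_fun_sum hf, sum_apply]

lemma partialDown_mul {f g : Minkowski → ℝ} {β : Minkowski} (hf : DifferentiableAt ℝ f β)
    (hg : DifferentiableAt ℝ g β) (μ : Fin 4) :
    partialDown μ (fun b => f b * g b) β = f β * partialDown μ g β + partialDown μ f β * g β := by
  simp only [partialDown, fderiv_fun_mul hf hg, add_apply,
    smul_apply, smul_eq_mul]
  ring

lemma partialDown_const_mul {f : Minkowski → ℝ} {β : Minkowski} (hf : DifferentiableAt ℝ f β)
    (c : ℝ) (μ : Fin 4) :
    partialDown μ (fun b => c * f b) β = c * partialDown μ f β := by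
  simp only [partialDown, fderiv_const_mul hf, smul_apply, smul_eq_mul]

lemma partialDown_coord (μ ν : Fin 4) (β : Minkowski) :
    partialDown μ (fun b => b ν) β = if ν = μ then 1 else 0 := by
  have : HasFDerivAt (fun b : Minkowski => b ν)
      (ContinuousLinearMap.proj (R := ℝ) (φ := fun _ : Fin 4 => ℝ) ν) β :=
    (ContinuousLinearMap.proj (R := ℝ) (φ := fun _ : Fin 4 => ℝ) ν).hasFDerivAt
  rw [partialDown, this.fderiv]
  simp [Pi.single_apply]

lemma contDiffAt_partialDown {f : Minkowski → F} {β : Minkowski} (hf : ContDiffAt ℝ ∞ f β)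
    (μ : Fin 4) : ContDiffAt ℝ ∞ (partialDown μ f) β :=
  (hf.fderiv_right (m := ∞) (by simp)).clm_apply contDiffAt_const

lemma contDiff_partialDown {f : Minkowski → F} (hf : ContDiff ℝ ∞ f)
    (μ : Fin 4) : ContDiff ℝ ∞ (partialDown μ f) :=
  contDiff_iff_contDiffAt.2 fun _ => contDiffAt_partialDown hf.contDiffAt μ

lemma fderiv_partialDown_apply {f : Minkowski → F} {β : Minkowski} (hf : ContDiffAt ℝ ∞ f β)
    (μ : Fin 4) (v : Minkowski) :
    fderiv ℝ (partialDown μ f) β v = fderiv ℝ (fderiv ℝ f) β v (Pi.single μ 1) := by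
  have h : DifferentiableAt ℝ (fderiv ℝ f) β :=
    (hf.fderiv_right (m := ∞) (by simp)).differentiableAt (by simp)
  have := h.hasFDerivAt.clm_apply (hasFDerivAt_const (Pi.single μ (1 : ℝ)) β)
  have h2 := this.fderiv
  change (fderiv ℝ (fun b => (fderiv ℝ f b) (Pi.single μ 1)) β) v = _
  rw [h2]
  simp

lemma partialDown_comm {f : Minkowski → F} {β : Minkowski} (hf : ContDiffAt ℝ ∞ f β)
    (μ ν : Fin 4) :
    partialDown μ (partialDown ν f) β = partialDown ν (partialDown μ f) β := by
  rw [partialDown, fderiv_partialDown_apply hf, partialDown, fderiv_partialDown_apply hf]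
  exact (hf.isSymmSndFDerivAt (by simpa using WithTop.coe_le_coe.2 (le_top : (2 : ℕ∞) ≤ ⊤))).eq _ _

lemma partialDown_partialUp {f : Minkowski → F} {β : Minkowski} (hf : ContDiffAt ℝ ∞ f β)
    (μ ν : Fin 4) :
    partialDown ν (partialUp μ f) β = eta μ • partialDown ν (partialDown μ f) β := by
  have h := (contDiffAt_partialDown hf μ).differentiableAt (by simp)
  change (fderiv ℝ (fun b => eta μ • partialDown μ f b) β) _ = _
  rw [fderiv_fun_const_smul h]
  rfl

lemma box_eq_sum {f : Minkowski → F} {β : Minkowski} (hf : ContDiffAt ℝ ∞ f β) :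
    box f β = ∑ μ, eta μ • partialDown μ (partialDown μ f) β := by
  simp only [box, partialDown_partialUp hf]

end Partial

/-! ### Minkowski geometry -/

/-- The Minkowski inner product. -/
def mdot (a b : Minkowski) : ℝ := ∑ μ, eta μ * a μ * b μ

lemma mdot_eq (a b : Minkowski) :
    mdot a b = a 0 * b 0 - a 1 * b 1 - a 2 * b 2 - a 3 * b 3 := by
  simp [mdot, Fin.sum_univ_four, eta]; ring

lemma sq_eq (a : Minkowski) : sq a = a 0 ^ 2 - a 1 ^ 2 - a 2 ^ 2 - a 3 ^ 2 := by
  simp [sq, Fin.sum_univ_four, eta]; ring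

lemma contDiff_sq {n : WithTop ℕ∞} : ContDiff ℝ n sq := by
  unfold sq; fun_prop

lemma contDiff_mdot {n : WithTop ℕ∞} (a : Minkowski) : ContDiff ℝ n (mdot a) := by
  unfold mdot; fun_prop

lemma partialDown_sq (μ : Fin 4) (β : Minkowski) :
    partialDown μ sq β = 2 * eta μ * β μ := by
  have h : ∀ ν : Fin 4, DifferentiableAt ℝ (fun b : Minkowski => b ν) β := fun ν => by fun_prop
  have : sq = fun b : Minkowski => ∑ ν, eta ν * (b ν * b ν) := by
    ext b; simp only [sq, pow_two]
  rw [this, partialDown_sum _ (fun ν _ => ((h ν).fun_mul (h ν)).const_mul _)]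
  simp_rw [partialDown_const_mul ((h _).fun_mul (h _)), partialDown_mul (h _) (h _), partialDown_coord]
  rw [Finset.sum_eq_single μ (fun ν _ hν => by simp [hν]) (by simp)]
  simp; ring

lemma partialDown_mdot (a : Minkowski) (μ : Fin 4) (β : Minkowski) :
    partialDown μ (mdot a) β = eta μ * a μ := by
  have h : ∀ ν : Fin 4, DifferentiableAt ℝ (fun b : Minkowski => b ν) β := fun ν => by fun_prop
  have : mdot a = fun b : Minkowski => ∑ ν, eta ν * a ν * b ν := rfl
  rw [this, partialDown_sum _ (fun ν _ => (h ν).const_mul _)]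
  simp_rw [partialDown_const_mul (h _), partialDown_coord]
  simp

lemma isOpen_forwardCone : IsOpen forwardCone :=
  (isOpen_lt continuous_const (continuous_apply 0)).inter
    (isOpen_lt continuous_const (contDiff_sq (n := 0)).continuous)

/-- Nonzero vectors on the boundary of the forward cone. -/
def IsFutureNull (n : Minkowski) : Prop := 0 < n 0 ∧ sq n = 0

/-- Cauchy–Schwarz for the spatial parts. Positivity confines the argument of a plane wave to the
positive half-line, where the parity of an approximating polynomial can be chosen freely. -/
lemma mdot_pos {n β : Minkowski} (hn : IsFutureNull n) (hβ : β ∈ forwardCone) : 0 < mdot n β := by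
  obtain ⟨hn0, hn⟩ := hn
  obtain ⟨hb0, hb⟩ := hβ
  rw [sq_eq] at hn hb
  rw [mdot_eq]
  by_contra! h
  have h1 : n 0 * β 0 ≤ n 1 * β 1 + n 2 * β 2 + n 3 * β 3 := by linarith
  have h2 : (n 0 * β 0) ^ 2 ≤ (n 1 * β 1 + n 2 * β 2 + n 3 * β 3) ^ 2 :=
    pow_le_pow_left₀ (by positivity) h1 2
  have h3 : (n 1 * β 1 + n 2 * β 2 + n 3 * β 3) ^ 2 ≤
      (n 1 ^ 2 + n 2 ^ 2 + n 3 ^ 2) * (β 1 ^ 2 + β 2 ^ 2 + β 3 ^ 2) := by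
    nlinarith [sq_nonneg (n 1 * β 2 - n 2 * β 1), sq_nonneg (n 1 * β 3 - n 3 * β 1),
      sq_nonneg (n 2 * β 3 - n 3 * β 2)]
  have h4 : n 1 ^ 2 + n 2 ^ 2 + n 3 ^ 2 = n 0 ^ 2 := by linarith
  rw [h4] at h3
  nlinarith [mul_pos (pow_pos hn0 2) hb]

/-- The cross term is positive and the quadratic one vanishes. Kirchhoff's formula can thus be used
from any point of the cone towards the future. -/
lemma add_smul_null_mem {n β : Minkowski} (hn : IsFutureNull n) (hβ : β ∈ forwardCone) {s : ℝ}
    (hs : 0 ≤ s) : β + s • n ∈ forwardCone := by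
  have h1 := mdot_pos hn hβ
  refine ⟨?_, ?_⟩
  · simp only [Pi.add_apply, Pi.smul_apply, smul_eq_mul]
    have := hβ.1; have := hn.1; positivity
  · have : sq (β + s • n) = sq β + 2 * s * mdot n β + s ^ 2 * sq n := by
      simp only [sq_eq, mdot_eq, Pi.add_apply, Pi.smul_apply, smul_eq_mul]; ring
    rw [this, hn.2]
    have := hβ.2
    positivity

/-! ### The Kelvin transform -/

/-- Inversion in the unit hyperboloid. -/
def inversion (β : Minkowski) : Minkowski := (sq β)⁻¹ • β

/-- The Kelvin transform `f ↦ (β²)⁻¹ f(β / β²)`. -/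
def kelvin (f : Minkowski → ℝ) (β : Minkowski) : ℝ := (sq β)⁻¹ * f (inversion β)

/-- The generator of special conformal transformations, which the Kelvin transform intertwines
with the partial derivative `∂_μ`. -/
def conformalGen (μ : Fin 4) (f : Minkowski → ℝ) (y : Minkowski) : ℝ :=
  sq y * partialDown μ f y - 2 * eta μ * y μ * (f y + ∑ ν, y ν * partialDown ν f y)

lemma sq_smul (c : ℝ) (β : Minkowski) : sq (c • β) = c ^ 2 * sq β := by
  simp only [sq_eq, Pi.smul_apply, smul_eq_mul]; ring

lemma sq_inversion {β : Minkowski} (h : sq β ≠ 0) : sq (inversion β) = (sq β)⁻¹ := by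
  rw [inversion, sq_smul]; field_simp

lemma inversion_mem {β : Minkowski} (h : β ∈ forwardCone) : inversion β ∈ forwardCone := by
  have h2 := h.2
  refine ⟨?_, ?_⟩
  · have := h.1
    simp only [inversion, Pi.smul_apply, smul_eq_mul]; positivity
  · rw [sq_inversion h2.ne']; positivity

lemma inversion_inversion {β : Minkowski} (h : sq β ≠ 0) : inversion (inversion β) = β := by
  rw [inversion, sq_inversion h, inversion, smul_smul, inv_inv, mul_inv_cancel₀ h, one_smul]

lemma kelvin_kelvin (f : Minkowski → ℝ) {β : Minkowski} (h : sq β ≠ 0) :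
    kelvin (kelvin f) β = f β := by
  rw [kelvin, kelvin, inversion_inversion h, sq_inversion h, inv_inv, ← mul_assoc,
    inv_mul_cancel₀ h, one_mul]

lemma contDiffAt_inversion {n : WithTop ℕ∞} {β : Minkowski} (h : sq β ≠ 0) :
    ContDiffAt ℝ n inversion β :=
  (contDiff_sq.contDiffAt.inv h).smul contDiffAt_id

lemma contDiffAt_kelvin {n : WithTop ℕ∞} {f : Minkowski → ℝ} {β : Minkowski} (h : sq β ≠ 0)
    (hf : ContDiffAt ℝ n f (inversion β)) : ContDiffAt ℝ n (kelvin f) β :=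
  (contDiff_sq.contDiffAt.inv h).mul (hf.comp β (contDiffAt_inversion h))

lemma partialDown_inv_sq {β : Minkowski} (h : sq β ≠ 0) (μ : Fin 4) :
    partialDown μ (fun b => (sq b)⁻¹) β = -(2 * eta μ * β μ) / sq β ^ 2 := by
  have hs : HasFDerivAt sq (fderiv ℝ sq β) β :=
    ((contDiff_sq (n := 1)).differentiable (by simp) β).hasFDerivAt
  have := (hasDerivAt_inv h).comp_hasFDerivAt β hs
  rw [partialDown]
  change (fderiv ℝ ((fun x => x⁻¹) ∘ sq) β) _ = _
  rw [this.fderiv]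
  have h3 := partialDown_sq μ β
  rw [partialDown] at h3
  simp only [smul_apply, h3, smul_eq_mul]
  ring

lemma partialDown_inversion {β : Minkowski} (h : sq β ≠ 0) (μ : Fin 4) :
    partialDown μ inversion β =
      (sq β)⁻¹ • Pi.single μ 1 + (-(2 * eta μ * β μ) / sq β ^ 2) • β := by
  have hs : DifferentiableAt ℝ (fun b => (sq b)⁻¹) β :=
    (contDiff_sq.contDiffAt.inv h : ContDiffAt ℝ 1 _ β).differentiableAt (by simp)
  have := hs.hasFDerivAt.fun_smul (hasFDerivAt_id β)
  have h3 := partialDown_inv_sq h μ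
  rw [partialDown] at h3
  rw [partialDown]
  change (fderiv ℝ (fun b => (sq b)⁻¹ • id b) β) _ = _
  rw [this.fderiv]
  simp [h3]

/-- Product and chain rule, with `β` rewritten as `sq β • inversion β` so that only the inverted
point remains. Differentiating the prefactor gives the term `f y`, and the radial part of the
derivative of the inversion gives the Euler operator. -/
lemma partialDown_kelvin {f : Minkowski → ℝ} {β : Minkowski} (h : sq β ≠ 0)
    (hf : DifferentiableAt ℝ f (inversion β)) (μ : Fin 4) :
    partialDown μ (kelvin f) β = kelvin (conformalGen μ f) β := by
  have hs : DifferentiableAt ℝ (fun b => (sq b)⁻¹) β :=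
    (contDiff_sq.contDiffAt.inv h : ContDiffAt ℝ 1 _ β).differentiableAt (by simp)
  have hi : DifferentiableAt ℝ inversion β :=
    (contDiffAt_inversion (n := 1) h).differentiableAt (by simp)
  have hfi : DifferentiableAt ℝ (fun b => f (inversion b)) β := hf.comp β hi
  have hc : partialDown μ (fun b => f (inversion b)) β =
      fderiv ℝ f (inversion β) (partialDown μ inversion β) := by
    rw [partialDown, partialDown]
    change (fderiv ℝ (f ∘ inversion) β) _ = _
    rw [fderiv_comp β hf hi]; rfl
  have h4 : β = sq β • inversion β := by
    rw [inversion, smul_smul, mul_inv_cancel₀ h, one_smul]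
  have hd : fderiv ℝ f (inversion β) β =
      sq β * ∑ ν, inversion β ν • partialDown ν f (inversion β) := by
    rw [← smul_eq_mul, ← fderiv_apply_eq_sum f (inversion β) (inversion β), ← map_smul, ← h4]
  change partialDown μ (fun b => (sq b)⁻¹ * f (inversion b)) β = _
  rw [partialDown_mul hs hfi, partialDown_inv_sq h, hc, partialDown_inversion h, map_add,
    map_smul, map_smul, hd, kelvin, conformalGen, sq_inversion h]
  have h5 : β μ = sq β * inversion β μ := by
    conv_lhs => rw [h4]
    rfl
  rw [h5]
  change _ = (sq β)⁻¹ * ((sq β)⁻¹ * (fderiv ℝ f (inversion β)) (Pi.single μ 1) - _)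
  simp only [smul_eq_mul]
  field_simp
  ring

lemma contDiffAt_conformalGen {f : Minkowski → ℝ} {y : Minkowski} (hf : ContDiffAt ℝ ∞ f y)
    (μ : Fin 4) : ContDiffAt ℝ ∞ (conformalGen μ f) y := by
  have h := fun ν => contDiffAt_partialDown hf ν
  have hc : ∀ ν : Fin 4, ContDiffAt ℝ ∞ (fun b : Minkowski => b ν) y := fun ν => by fun_prop
  exact (contDiff_sq.contDiffAt.mul (h μ)).sub
    ((contDiffAt_const.mul (hc μ)).mul (hf.add (ContDiffAt.sum fun ν _ => (hc ν).mul (h ν))))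

lemma partialDown_conformalGen {f : Minkowski → ℝ} {y : Minkowski} (hf : ContDiffAt ℝ ∞ f y)
    (μ ν : Fin 4) :
    partialDown ν (conformalGen μ f) y =
      2 * eta ν * y ν * partialDown μ f y + sq y * partialDown ν (partialDown μ f) y
      - 2 * eta μ * (if μ = ν then 1 else 0) * (f y + ∑ l, y l * partialDown l f y)
      - 2 * eta μ * y μ *
        (2 * partialDown ν f y + ∑ l, y l * partialDown ν (partialDown l f) y) := by
  have h : ∀ l, DifferentiableAt ℝ (partialDown l f) y := fun l =>
    (contDiffAt_partialDown hf l).differentiableAt (by simp)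
  have h0 : DifferentiableAt ℝ f y := hf.differentiableAt (by simp)
  have hs : DifferentiableAt ℝ sq y := (contDiff_sq (n := 1)).differentiable (by simp) y
  have hc : ∀ l : Fin 4, DifferentiableAt ℝ (fun b : Minkowski => b l) y := fun l => by fun_prop
  have hS : DifferentiableAt ℝ (fun b => ∑ l, b l * partialDown l f b) y :=
    DifferentiableAt.fun_sum fun l _ => (hc l).fun_mul (h l)
  change partialDown ν (fun b => sq b * partialDown μ f b -
    2 * eta μ * b μ * (f b + ∑ l, b l * partialDown l f b)) y = _
  rw [partialDown_sub (hs.fun_mul (h μ)) (((hc μ).const_mul _).fun_mul (h0.fun_add hS)),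
    partialDown_mul hs (h μ), partialDown_mul ((hc μ).const_mul _) (h0.fun_add hS),
    partialDown_const_mul (hc μ), partialDown_coord, partialDown_add h0 hS,
    partialDown_sum _ (fun l _ => (hc l).fun_mul (h l)), partialDown_sq]
  simp_rw [partialDown_mul (hc _) (h _), partialDown_coord]
  rw [Finset.sum_add_distrib]
  simp only [ite_mul, one_mul, zero_mul, Finset.sum_ite_eq', Finset.mem_univ, if_true]
  ring

/-- This holds for every smooth `f`, not only for solutions. The lower-order terms cancel because
the conformal weight 1 of the generators is the right one in dimension 4; second derivatives only
need to be symmetric. -/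
lemma sum_conformalGen_conformalGen {f : Minkowski → ℝ} {y : Minkowski}
    (hf : ContDiffAt ℝ ∞ f y) :
    ∑ μ, eta μ * conformalGen μ (conformalGen μ f) y =
      sq y ^ 2 * ∑ μ, eta μ * partialDown μ (partialDown μ f) y := by
  have e : ∀ μ, eta μ * conformalGen μ (conformalGen μ f) y =
      eta μ * (sq y * partialDown μ (conformalGen μ f) y) - 2 * (eta μ * eta μ) * y μ *
        (conformalGen μ f y + ∑ ν, y ν * partialDown ν (conformalGen μ f) y) := by
    intro μ
    rw [conformalGen]; ring
  simp_rw [e, eta_mul_self, partialDown_conformalGen hf, conformalGen, Fin.sum_univ_four]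
  have c := fun μ ν => partialDown_comm hf μ ν
  rw [c 1 0, c 2 0, c 3 0, c 2 1, c 3 1, c 3 2]
  simp [eta, sq_eq]
  ring

lemma IsSmoothWaveSolution.contDiffAt {F : Type*} [NormedAddCommGroup F] [NormedSpace ℝ F]
    {f : Minkowski → F} (hf : IsSmoothWaveSolution f)
    {β : Minkowski} (hβ : β ∈ forwardCone) : ContDiffAt ℝ ∞ f β :=
  hf.smooth.contDiffAt (isOpen_forwardCone.mem_nhds hβ)

theorem IsSmoothWaveSolution.kelvin {f : Minkowski → ℝ} (hf : IsSmoothWaveSolution f) :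
    IsSmoothWaveSolution (kelvin f) := by
  have hs : ∀ β ∈ forwardCone, ContDiffAt ℝ ∞ (Thermal.kelvin f) β := fun β hβ =>
    contDiffAt_kelvin hβ.2.ne' (hf.contDiffAt (inversion_mem hβ))
  refine ⟨fun β hβ => (hs β hβ).contDiffWithinAt, fun β hβ => ?_⟩
  have hc := hf.contDiffAt (inversion_mem hβ)
  have h1 : ∀ μ, partialDown μ (partialDown μ (Thermal.kelvin f)) β =
      Thermal.kelvin (conformalGen μ (conformalGen μ f)) β := by
    intro μ
    rw [← partialDown_kelvin hβ.2.ne'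
      ((contDiffAt_conformalGen hc μ).differentiableAt (by simp))]
    -- The outer derivative needs the first intertwining identity on a neighbourhood, not just at
    -- `β`.
    refine partialDown_congr ?_ μ
    filter_upwards [isOpen_forwardCone.mem_nhds hβ] with b hb
    exact partialDown_kelvin hb.2.ne'
      ((hf.contDiffAt (inversion_mem hb)).differentiableAt (by simp)) μ
  rw [box_eq_sum (hs β hβ)]
  simp_rw [h1, Thermal.kelvin, smul_eq_mul, mul_left_comm _ (sq β)⁻¹]
  rw [← Finset.mul_sum, sum_conformalGen_conformalGen hc]
  have := hf.wave _ (inversion_mem hβ)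
  rw [box_eq_sum hc] at this
  simp only [smul_eq_mul] at this
  rw [this]; simp

/-- The `C¹` size of `kelvin f` at `β` is controlled by that of `f` at `inversion β`, uniformly on
compact sets. -/
lemma exists_kelvin_bound {B : Set Minkowski} (hB : IsCompact B) (hBV : B ⊆ forwardCone) :
    ∃ C : ℝ, 0 < C ∧ ∀ f : Minkowski → ℝ, ∀ β ∈ B, ∀ δ : ℝ,
      DifferentiableAt ℝ f (inversion β) → |f (inversion β)| ≤ δ →
      (∀ μ, |partialDown μ f (inversion β)| ≤ δ) →
      |kelvin f β| ≤ C * δ ∧ ∀ μ, |partialDown μ (kelvin f) β| ≤ C * δ := by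
  -- The summand 1 bounds the value of `f`; the others bound the terms of `conformalGen`, the 4
  -- being the number of terms in the Euler operator.
  let g : Minkowski → ℝ := fun β => (sq β)⁻¹ *
    (1 + |sq (inversion β)| + 2 * ‖inversion β‖ * (1 + 4 * ‖inversion β‖))
  have hi : ContinuousOn inversion B := fun β hβ =>
    (contDiffAt_inversion (n := 0) (hBV hβ).2.ne').continuousAt.continuousWithinAt
  have hg : ContinuousOn g B := by
    have h1 : ContinuousOn (fun β => (sq β)⁻¹) B :=
      (contDiff_sq (n := 0)).continuous.continuousOn.inv₀ fun β hβ => (hBV hβ).2.ne'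
    have h2 : ContinuousOn (fun β => sq (inversion β)) B :=
      (contDiff_sq (n := 0)).continuous.comp_continuousOn hi
    exact h1.mul ((continuousOn_const.add h2.abs).add ((continuousOn_const.mul hi.norm).mul
      (continuousOn_const.add (continuousOn_const.mul hi.norm))))
  obtain ⟨C, hC⟩ := hB.exists_bound_of_continuousOn hg
  refine ⟨max C 1, by positivity, fun f β hβ δ hf h0 hp => ?_⟩
  have hδ : 0 ≤ δ := (abs_nonneg _).trans h0
  have hq := (hBV hβ).2
  have hgC : g β * δ ≤ max C 1 * δ :=
    mul_le_mul_of_nonneg_right (((le_abs_self _).trans (hC β hβ)).trans (le_max_left _ _)) hδ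
  have hn : ∀ μ, |inversion β μ| ≤ ‖inversion β‖ := fun μ => norm_le_pi_norm (inversion β) μ
  set y := inversion β
  have hy : 0 ≤ ‖y‖ := norm_nonneg _
  refine ⟨le_trans ?_ hgC, fun μ => le_trans ?_ hgC⟩
  · rw [kelvin, abs_mul, abs_of_pos (inv_pos.2 hq), mul_assoc]
    refine mul_le_mul_of_nonneg_left (h0.trans ?_) (inv_pos.2 hq).le
    have : 0 ≤ |sq y| + 2 * ‖y‖ * (1 + 4 * ‖y‖) := by positivity
    nlinarith
  · rw [partialDown_kelvin hq.ne' hf, kelvin, abs_mul, abs_of_pos (inv_pos.2 hq), mul_assoc]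
    refine mul_le_mul_of_nonneg_left ?_ (inv_pos.2 hq).le
    have hS : |∑ ν, y ν * partialDown ν f y| ≤ 4 * ‖y‖ * δ := by
      refine (Finset.abs_sum_le_sum_abs _ _).trans ?_
      refine (Finset.sum_le_card_nsmul _ _ (‖y‖ * δ) fun ν _ => ?_).trans (by simp; linarith)
      rw [abs_mul]
      exact mul_le_mul (hn ν) (hp ν) (abs_nonneg _) hy
    have h2 : |f y + ∑ ν, y ν * partialDown ν f y| ≤ (1 + 4 * ‖y‖) * δ :=
      (abs_add_le _ _).trans (by linarith)
    have h3 : |2 * eta μ * y μ * (f y + ∑ ν, y ν * partialDown ν f y)| ≤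
        2 * ‖y‖ * ((1 + 4 * ‖y‖) * δ) := by
      rw [abs_mul, abs_mul, abs_mul, abs_eta, abs_two, mul_one]
      exact mul_le_mul (mul_le_mul_of_nonneg_left (hn μ) two_pos.le) h2 (abs_nonneg _)
        (by positivity)
    have h4 : |sq y * partialDown μ f y| ≤ |sq y| * δ := by
      rw [abs_mul]; exact mul_le_mul_of_nonneg_left (hp μ) (abs_nonneg _)
    refine (abs_sub _ _).trans ?_
    linarith

/-! ### Kirchhoff's formula -/

open Real MeasureTheory

/-- The future null vector `(1, ω)`, `ω` the point of the unit sphere with polar angle `θ` and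
azimuth `φ`. -/
def nullDir (θ φ : ℝ) : Minkowski := ![1, sin θ * cos φ, sin θ * sin φ, cos θ]

/-- The components of the null vector `(-1, ω)`. -/
def nullDirConj (θ φ : ℝ) : Minkowski := ![-1, sin θ * cos φ, sin θ * sin φ, cos θ]

lemma isFutureNull_nullDir (θ φ : ℝ) : IsFutureNull (nullDir θ φ) := by
  refine ⟨by simp [nullDir], ?_⟩
  simp only [sq_eq, nullDir, Matrix.cons_val]
  linear_combination -sin θ ^ 2 * sin_sq_add_cos_sq φ - sin_sq_add_cos_sq θ

lemma continuous_nullDir : Continuous fun q : ℝ × ℝ => nullDir q.1 q.2 := by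
  refine continuous_pi fun i => ?_
  fin_cases i <;> simp [nullDir] <;> fun_prop

lemma hasDerivAt_comp_curve {g : Minkowski → ℝ} {c : ℝ → Minkowski} {c' : Minkowski} {t : ℝ}
    (hg : DifferentiableAt ℝ g (c t)) (hc : HasDerivAt c c' t) :
    HasDerivAt (fun x => g (c x)) (∑ μ, c' μ * partialDown μ g (c t)) t := by
  have := hg.hasFDerivAt.comp_hasDerivAt t hc
  rw [fderiv_apply_eq_sum] at this
  exact this

lemma hasDerivAt_coneRay (β : Minkowski) (s θ φ : ℝ) :
    HasDerivAt (fun s => β + s • nullDir θ φ) (nullDir θ φ) s := by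
  simpa using ((hasDerivAt_id s).smul_const (nullDir θ φ)).const_add β

lemma hasDerivAt_nullDir_polar (β : Minkowski) (s θ φ : ℝ) :
    HasDerivAt (fun θ => β + s • nullDir θ φ)
      (s • ![0, cos θ * cos φ, cos θ * sin φ, -sin θ]) θ := by
  refine HasDerivAt.const_add β (HasDerivAt.const_smul s (hasDerivAt_pi.2 fun i => ?_))
  fin_cases i
  · simpa [nullDir] using hasDerivAt_const θ (1 : ℝ)
  · simpa [nullDir] using (hasDerivAt_sin θ).mul_const (cos φ)
  · simpa [nullDir] using (hasDerivAt_sin θ).mul_const (sin φ)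
  · simpa [nullDir] using hasDerivAt_cos θ

lemma hasDerivAt_nullDir_azimuth (β : Minkowski) (s θ φ : ℝ) :
    HasDerivAt (fun φ => β + s • nullDir θ φ)
      (s • ![0, -(sin θ * sin φ), sin θ * cos φ, 0]) φ := by
  refine HasDerivAt.const_add β (HasDerivAt.const_smul s (hasDerivAt_pi.2 fun i => ?_))
  fin_cases i
  · simpa [nullDir] using hasDerivAt_const φ (1 : ℝ)
  · simpa [nullDir] using (hasDerivAt_cos φ).const_mul (sin θ)
  · simpa [nullDir] using (hasDerivAt_sin φ).const_mul (sin θ)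
  · simpa [nullDir] using hasDerivAt_const φ (cos θ)

lemma continuous_partialDown {u : Minkowski → ℝ} (hu : ContDiff ℝ ∞ u) (μ : Fin 4) :
    Continuous (partialDown μ u) := (contDiff_partialDown hu μ).continuous

/-- The integrand of Kirchhoff's formula. -/
def kirchhoffIntegrand (u : Minkowski → ℝ) (β : Minkowski) (s θ φ : ℝ) : ℝ :=
  (u (β + s • nullDir θ φ) + s * ∑ μ, nullDirConj θ φ μ * partialDown μ u (β + s • nullDir θ φ)) *
    sin θ

/-- The derivative of the Kirchhoff integrand along the light cone. -/
def kirchhoffDeriv (u : Minkowski → ℝ) (β : Minkowski) (s θ φ : ℝ) : ℝ :=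
  ((∑ μ, (nullDir θ φ μ + nullDirConj θ φ μ) * partialDown μ u (β + s • nullDir θ φ)) +
    s * ∑ μ, nullDirConj θ φ μ * ∑ ν, nullDir θ φ ν *
      partialDown ν (partialDown μ u) (β + s • nullDir θ φ)) * sin θ

variable {u : Minkowski → ℝ}

lemma hasDerivAt_kirchhoffIntegrand (hu : ContDiff ℝ ∞ u) (β : Minkowski) (s θ φ : ℝ) :
    HasDerivAt (fun s => kirchhoffIntegrand u β s θ φ) (kirchhoffDeriv u β s θ φ) s := by
  have h0 := hasDerivAt_comp_curve (hu.differentiable (by simp) _) (hasDerivAt_coneRay β s θ φ)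
  have h1 : ∀ μ, HasDerivAt (fun s => nullDirConj θ φ μ * partialDown μ u (β + s • nullDir θ φ))
      (nullDirConj θ φ μ * ∑ ν, nullDir θ φ ν *
        partialDown ν (partialDown μ u) (β + s • nullDir θ φ)) s := fun μ =>
    (hasDerivAt_comp_curve ((contDiff_partialDown hu μ).differentiable (by simp) _)
      (hasDerivAt_coneRay β s θ φ)).const_mul _
  have h2 := (h0.add ((hasDerivAt_id s).mul
    (HasDerivAt.fun_sum (u := Finset.univ) fun μ _ => h1 μ))).mul_const (sin θ)
  refine HasDerivAt.congr_deriv h2 ?_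
  simp only [kirchhoffDeriv, add_mul, Finset.sum_add_distrib, id]
  ring

lemma continuous_along_cone {X : Type*} [TopologicalSpace X] {g : Minkowski → ℝ}
    (hg : Continuous g) (β : Minkowski) {s θ φ : X → ℝ} (hs : Continuous s) (hθ : Continuous θ)
    (hφ : Continuous φ) : Continuous fun x => g (β + s x • nullDir (θ x) (φ x)) := by
  have h : Continuous fun x => nullDir (θ x) (φ x) :=
    continuous_nullDir.comp (f := fun x => (θ x, φ x)) (hθ.prodMk hφ)
  exact hg.comp (continuous_const.add (hs.smul h))

lemma continuous_kirchhoffDeriv (hu : ContDiff ℝ ∞ u) (β : Minkowski) :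
    Continuous fun x : ℝ × ℝ × ℝ => kirchhoffDeriv u β x.1 x.2.1 x.2.2 := by
  have h1 := fun μ => continuous_along_cone (continuous_partialDown hu μ) β
    (X := ℝ × ℝ × ℝ) continuous_fst continuous_snd.fst continuous_snd.snd
  have h2 := fun μ ν => continuous_along_cone
    (continuous_partialDown (contDiff_partialDown hu μ) ν) β
    (X := ℝ × ℝ × ℝ) continuous_fst continuous_snd.fst continuous_snd.snd
  simp only [kirchhoffDeriv, Fin.sum_univ_four, nullDir, nullDirConj, Matrix.cons_val] at h1 h2 ⊢
  fun_prop

lemma continuous_kirchhoffIntegrand (hu : ContDiff ℝ ∞ u) (β : Minkowski) :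
    Continuous fun x : ℝ × ℝ × ℝ => kirchhoffIntegrand u β x.1 x.2.1 x.2.2 := by
  have h0 := continuous_along_cone hu.continuous β
    (X := ℝ × ℝ × ℝ) continuous_fst continuous_snd.fst continuous_snd.snd
  have h1 := fun μ => continuous_along_cone (continuous_partialDown hu μ) β
    (X := ℝ × ℝ × ℝ) continuous_fst continuous_snd.fst continuous_snd.snd
  simp only [kirchhoffIntegrand, Fin.sum_univ_four, nullDir, nullDirConj, Matrix.cons_val]
    at h0 h1 ⊢
  fun_prop

/-- The polar component of the angular divergence. -/
def polarFlux (u : Minkowski → ℝ) (β : Minkowski) (s θ φ : ℝ) : ℝ :=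
  sin θ * (cos θ * cos φ * partialDown 1 u (β + s • nullDir θ φ) +
    cos θ * sin φ * partialDown 2 u (β + s • nullDir θ φ) -
    sin θ * partialDown 3 u (β + s • nullDir θ φ))

/-- The azimuthal component of the angular divergence. -/
def azimuthFlux (u : Minkowski → ℝ) (β : Minkowski) (s θ φ : ℝ) : ℝ :=
  cos φ * partialDown 2 u (β + s • nullDir θ φ) - sin φ * partialDown 1 u (β + s • nullDir θ φ)

/-- The derivative of `polarFlux` in the polar angle. -/
def polarFluxDeriv (u : Minkowski → ℝ) (β : Minkowski) (s θ φ : ℝ) : ℝ :=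
  let p := β + s • nullDir θ φ
  let d : Fin 4 → ℝ := fun μ => s * (cos θ * cos φ * partialDown 1 (partialDown μ u) p +
    cos θ * sin φ * partialDown 2 (partialDown μ u) p - sin θ * partialDown 3 (partialDown μ u) p)
  cos θ * (cos θ * cos φ * partialDown 1 u p + cos θ * sin φ * partialDown 2 u p -
    sin θ * partialDown 3 u p) +
  sin θ * (-sin θ * cos φ * partialDown 1 u p - sin θ * sin φ * partialDown 2 u p -
    cos θ * partialDown 3 u p + cos θ * cos φ * d 1 + cos θ * sin φ * d 2 - sin θ * d 3)

/-- The derivative of `azimuthFlux` in the azimuth. -/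
def azimuthFluxDeriv (u : Minkowski → ℝ) (β : Minkowski) (s θ φ : ℝ) : ℝ :=
  let p := β + s • nullDir θ φ
  let d : Fin 4 → ℝ := fun μ => s * (sin θ * cos φ * partialDown 2 (partialDown μ u) p -
    sin θ * sin φ * partialDown 1 (partialDown μ u) p)
  cos φ * d 2 - sin φ * d 1 - sin φ * partialDown 2 u p - cos φ * partialDown 1 u p

lemma hasDerivAt_polarFlux (hu : ContDiff ℝ ∞ u) (β : Minkowski) (s θ φ : ℝ) :
    HasDerivAt (fun θ => polarFlux u β s θ φ) (polarFluxDeriv u β s θ φ) θ := by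
  have h1 := fun μ => hasDerivAt_comp_curve
    ((contDiff_partialDown hu μ).differentiable (by simp) _) (hasDerivAt_nullDir_polar β s θ φ)
  have hs := hasDerivAt_sin θ
  have hc := hasDerivAt_cos θ
  have := hs.mul ((((hc.mul_const (cos φ)).mul (h1 1)).add
    ((hc.mul_const (sin φ)).mul (h1 2))).sub (hs.mul (h1 3)))
  refine HasDerivAt.congr_deriv this ?_
  simp only [polarFluxDeriv, Fin.sum_univ_four, Pi.smul_apply, Matrix.cons_val, smul_eq_mul,
    Pi.add_apply, Pi.sub_apply, Pi.mul_apply]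
  ring

lemma hasDerivAt_azimuthFlux (hu : ContDiff ℝ ∞ u) (β : Minkowski) (s θ φ : ℝ) :
    HasDerivAt (fun φ => azimuthFlux u β s θ φ) (azimuthFluxDeriv u β s θ φ) φ := by
  have h1 := fun μ => hasDerivAt_comp_curve
    ((contDiff_partialDown hu μ).differentiable (by simp) _) (hasDerivAt_nullDir_azimuth β s θ φ)
  have := ((hasDerivAt_cos φ).mul (h1 2)).sub ((hasDerivAt_sin φ).mul (h1 1))
  refine HasDerivAt.congr_deriv this ?_
  simp only [azimuthFluxDeriv, Fin.sum_univ_four, Pi.smul_apply, Matrix.cons_val, smul_eq_mul]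
  ring

lemma continuous_polarFluxDeriv (hu : ContDiff ℝ ∞ u) (β : Minkowski) (s : ℝ) :
    Continuous fun x : ℝ × ℝ => polarFluxDeriv u β s x.1 x.2 := by
  have h1 := fun μ => continuous_along_cone (continuous_partialDown hu μ) β
    (X := ℝ × ℝ) (s := fun _ => s) continuous_const continuous_fst continuous_snd
  have h2 := fun μ ν => continuous_along_cone
    (continuous_partialDown (contDiff_partialDown hu μ) ν) β
    (X := ℝ × ℝ) (s := fun _ => s) continuous_const continuous_fst continuous_snd
  simp only [polarFluxDeriv]
  fun_prop

lemma continuous_azimuthFluxDeriv (hu : ContDiff ℝ ∞ u) (β : Minkowski) (s : ℝ) :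
    Continuous fun x : ℝ × ℝ => azimuthFluxDeriv u β s x.1 x.2 := by
  have h1 := fun μ => continuous_along_cone (continuous_partialDown hu μ) β
    (X := ℝ × ℝ) (s := fun _ => s) continuous_const continuous_fst continuous_snd
  have h2 := fun μ ν => continuous_along_cone
    (continuous_partialDown (contDiff_partialDown hu μ) ν) β
    (X := ℝ × ℝ) (s := fun _ => s) continuous_const continuous_fst continuous_snd
  simp only [azimuthFluxDeriv]
  fun_prop

/-- On solutions of the wave equation, the derivative of the Kirchhoff integrand along the light
cone is an angular divergence. -/
lemma kirchhoffDeriv_eq (hu : ContDiff ℝ ∞ u) {β : Minkowski} {s θ φ : ℝ}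
    (hbox : box u (β + s • nullDir θ φ) = 0) :
    kirchhoffDeriv u β s θ φ = -polarFluxDeriv u β s θ φ - azimuthFluxDeriv u β s θ φ := by
  rw [box_eq_sum hu.contDiffAt] at hbox
  have c := fun μ ν => partialDown_comm (hu.contDiffAt (x := β + s • nullDir θ φ)) μ ν
  -- With `r` the direction `ω`, the left side is `(2 ∂_r u + s (∂_r² - ∂_0²) u) sin θ`. The wave
  -- equation replaces `∂_0²` by the Laplacian, leaving minus the spherical Laplacian of `u` times
  -- `sin θ / s`. Writing the fluxes in Cartesian derivatives removes the divisions by `s` and `sin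
  -- θ`.
  simp only [kirchhoffDeriv, polarFluxDeriv, azimuthFluxDeriv]
  generalize β + s • nullDir θ φ = p at *
  simp only [Fin.sum_univ_four, eta, smul_eq_mul, Fin.isValue, if_true, one_ne_zero, if_false,
    Fin.reduceEq] at hbox
  simp only [Fin.sum_univ_four, nullDir, nullDirConj, Matrix.cons_val]
  rw [c 1 0, c 2 0, c 3 0, c 2 1, c 3 1, c 3 2]
  have e1 := sin_sq_add_cos_sq θ
  have e2 := sin_sq_add_cos_sq φ
  linear_combination (s * sin θ * (cos φ ^ 2 * partialDown 1 (partialDown 1 u) p +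
      sin φ ^ 2 * partialDown 2 (partialDown 2 u) p + partialDown 3 (partialDown 3 u) p +
      2 * cos φ * sin φ * partialDown 1 (partialDown 2 u) p) +
      cos φ * partialDown 1 u p + sin φ * partialDown 2 u p) * e1 +
    s * sin θ * (partialDown 1 (partialDown 1 u) p + partialDown 2 (partialDown 2 u) p) * e2 -
    s * sin θ * hbox

lemma intervalIntegral_swap_of_continuous {F : ℝ → ℝ → ℝ} (hF : Continuous F.uncurry)
    (a b c d : ℝ) : ∫ x in a..b, ∫ y in c..d, F x y = ∫ y in c..d, ∫ x in a..b, F x y := by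
  refine intervalIntegral_intervalIntegral_swap ?_
  exact (hF.continuousOn.integrableOn_compact
    (isCompact_uIcc.prod isCompact_uIcc)).mono_set <|
      Set.prod_mono Set.uIoc_subset_uIcc Set.uIoc_subset_uIcc

/-- The azimuthal flux is periodic in `φ`, and the polar flux carries a factor `sin θ` that vanishes
at both poles. -/
lemma integral_kirchhoffDeriv_eq_zero (hu : ContDiff ℝ ∞ u) {β : Minkowski} {s : ℝ}
    (hbox : ∀ θ φ, box u (β + s • nullDir θ φ) = 0) :
    ∫ θ in 0..π, ∫ φ in 0..(2 * π), kirchhoffDeriv u β s θ φ = 0 := by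
  have hp := continuous_polarFluxDeriv hu β s
  have ha := continuous_azimuthFluxDeriv hu β s
  have h1 : ∀ θ, ∫ φ in 0..(2 * π), kirchhoffDeriv u β s θ φ =
      -∫ φ in 0..(2 * π), polarFluxDeriv u β s θ φ := by
    intro θ
    have hpi : IntervalIntegrable (fun φ => polarFluxDeriv u β s θ φ) volume 0 (2 * π) :=
      (hp.comp (Continuous.prodMk_right θ)).intervalIntegrable _ _
    have hai : IntervalIntegrable (fun φ => azimuthFluxDeriv u β s θ φ) volume 0 (2 * π) :=
      (ha.comp (Continuous.prodMk_right θ)).intervalIntegrable _ _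
    have h2 : ∫ φ in 0..(2 * π), azimuthFluxDeriv u β s θ φ = 0 := by
      rw [intervalIntegral.integral_eq_sub_of_hasDerivAt
        (fun φ _ => hasDerivAt_azimuthFlux hu β s θ φ) hai]
      simp [azimuthFlux, nullDir]
    simp_rw [kirchhoffDeriv_eq hu (hbox θ _)]
    rw [intervalIntegral.integral_sub (f := fun φ => -polarFluxDeriv u β s θ φ) hpi.neg hai, h2,
      sub_zero, intervalIntegral.integral_neg]
  simp_rw [h1]
  rw [intervalIntegral.integral_neg, intervalIntegral_swap_of_continuous (F := polarFluxDeriv u β s) hp]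
  have h3 : ∀ φ, ∫ θ in 0..π, polarFluxDeriv u β s θ φ = 0 := by
    intro φ
    rw [intervalIntegral.integral_eq_sub_of_hasDerivAt
      (fun θ _ => hasDerivAt_polarFlux hu β s θ φ)
      ((hp.comp (Continuous.prodMk_left φ)).intervalIntegrable _ _)]
    simp [polarFlux]
  simp [h3]

/-- **Kirchhoff's formula** on the forward light cone of `β`. -/
theorem kirchhoff (hu : ContDiff ℝ ∞ u) {β : Minkowski} {S : ℝ} (hS : 0 ≤ S)
    (hbox : ∀ s, 0 ≤ s → s ≤ S → ∀ θ φ, box u (β + s • nullDir θ φ) = 0) :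
    ∫ θ in 0..π, ∫ φ in 0..(2 * π), kirchhoffIntegrand u β S θ φ = 4 * π * u β := by
  have hk := continuous_kirchhoffIntegrand hu β
  have hd := continuous_kirchhoffDeriv hu β
  -- At the tip of the cone only `u β` times the area element survives. The rest of the proof shows
  -- that the spherical integral does not depend on `s`.
  have h0 : ∫ θ in 0..π, ∫ φ in 0..(2 * π), kirchhoffIntegrand u β 0 θ φ = 4 * π * u β := by
    simp [kirchhoffIntegrand]
    ring
  have hk' : ∀ s, Continuous fun q : ℝ × ℝ => kirchhoffIntegrand u β s q.1 q.2 := fun s =>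
    hk.comp (f := fun q : ℝ × ℝ => (s, q.1, q.2)) (by fun_prop)
  have hki : ∀ s θ, IntervalIntegrable (fun φ => kirchhoffIntegrand u β s θ φ) volume 0 (2 * π) :=
    fun s θ => ((hk' s).comp (f := fun φ => (θ, φ)) (by fun_prop)).intervalIntegrable _ _
  have hkj : ∀ s, IntervalIntegrable
      (fun θ => ∫ φ in 0..(2 * π), kirchhoffIntegrand u β s θ φ) volume 0 π := fun s =>
    (intervalIntegral.continuous_parametric_intervalIntegral_of_continuous'
      (f := fun θ φ => kirchhoffIntegrand u β s θ φ) (hk' s)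
      0 (2 * π)).intervalIntegrable _ _
  rw [← sub_eq_zero, ← h0, ← intervalIntegral.integral_sub (hkj S) (hkj 0)]
  simp_rw [← intervalIntegral.integral_sub (hki S _) (hki 0 _)]
  have h1 : ∀ θ φ, kirchhoffIntegrand u β S θ φ - kirchhoffIntegrand u β 0 θ φ =
      ∫ s in 0..S, kirchhoffDeriv u β s θ φ := fun θ φ =>
    (intervalIntegral.integral_eq_sub_of_hasDerivAt
      (fun s _ => hasDerivAt_kirchhoffIntegrand hu β s θ φ)
      ((hd.comp (f := fun s => (s, θ, φ)) (by fun_prop)).intervalIntegrable _ _)).symm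
  simp_rw [h1]
  have h2 : ∀ θ, ∫ φ in 0..(2 * π), ∫ s in 0..S, kirchhoffDeriv u β s θ φ =
      ∫ s in 0..S, ∫ φ in 0..(2 * π), kirchhoffDeriv u β s θ φ := fun θ =>
    intervalIntegral_swap_of_continuous (F := fun φ s => kirchhoffDeriv u β s θ φ)
      (hd.comp (f := fun x : ℝ × ℝ => (x.2, θ, x.1)) (by fun_prop)) _ _ _ _
  simp_rw [h2]
  rw [intervalIntegral_swap_of_continuous]
  · rw [intervalIntegral.integral_congr (g := fun _ => (0 : ℝ))]
    · simp
    · intro s hs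
      rw [Set.uIcc_of_le hS] at hs
      exact integral_kirchhoffDeriv_eq_zero hu (hbox s hs.1 hs.2)
  · exact intervalIntegral.continuous_parametric_intervalIntegral_of_continuous'
      (f := fun (x : ℝ × ℝ) φ => kirchhoffDeriv u β x.2 x.1 φ)
      (hd.comp (f := fun x : (ℝ × ℝ) × ℝ => (x.1.2, x.1.1, x.2)) (by fun_prop)) _ _

lemma abs_nullDirConj_le (θ φ : ℝ) (μ : Fin 4) : |nullDirConj θ φ μ| ≤ 1 := by
  fin_cases μ <;> simp only [nullDirConj, Fin.zero_eta, Fin.mk_one, Fin.reduceFinMk,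
    Matrix.cons_val, abs_neg, abs_one, le_refl, abs_mul]
  · exact mul_le_one₀ (abs_sin_le_one θ) (abs_nonneg _) (abs_cos_le_one φ)
  · exact mul_le_one₀ (abs_sin_le_one θ) (abs_nonneg _) (abs_sin_le_one φ)
  · exact abs_cos_le_one θ

/-- The value of a solution at `β` is bounded by its Cauchy data at a later time, on the forward
light cone of `β`. -/
theorem abs_le_of_kirchhoff (hu : ContDiff ℝ ∞ u) {β : Minkowski} {S δ : ℝ} (hS : 0 ≤ S)
    (hbox : ∀ s, 0 ≤ s → s ≤ S → ∀ θ φ, box u (β + s • nullDir θ φ) = 0)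
    (h0 : ∀ θ φ, |u (β + S • nullDir θ φ)| ≤ δ)
    (h1 : ∀ θ φ μ, |partialDown μ u (β + S • nullDir θ φ)| ≤ δ) :
    |u β| ≤ 2 * (1 + 4 * S) * δ := by
  have hδ : 0 ≤ δ := (abs_nonneg _).trans (h0 0 0)
  have hb : ∀ θ φ, ‖kirchhoffIntegrand u β S θ φ‖ ≤ (1 + 4 * S) * δ := by
    intro θ φ
    rw [kirchhoffIntegrand, norm_mul, Real.norm_eq_abs, Real.norm_eq_abs]
    have h2 : |∑ μ, nullDirConj θ φ μ * partialDown μ u (β + S • nullDir θ φ)| ≤ 4 * δ := by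
      refine (Finset.abs_sum_le_sum_abs _ _).trans ?_
      refine (Finset.sum_le_card_nsmul _ _ δ fun μ _ => ?_).trans (by simp)
      rw [abs_mul]
      calc _ ≤ 1 * δ := mul_le_mul (abs_nullDirConj_le θ φ μ) (h1 θ φ μ) (abs_nonneg _)
            zero_le_one
        _ = δ := one_mul δ
    have h3 : |u (β + S • nullDir θ φ) +
        S * ∑ μ, nullDirConj θ φ μ * partialDown μ u (β + S • nullDir θ φ)| ≤
        (1 + 4 * S) * δ := by
      refine (abs_add_le _ _).trans ?_
      rw [abs_mul, abs_of_nonneg hS]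
      nlinarith [h0 θ φ, mul_le_mul_of_nonneg_left h2 hS]
    calc _ ≤ (1 + 4 * S) * δ * 1 := mul_le_mul h3 (abs_sin_le_one θ) (abs_nonneg _) (by positivity)
      _ = _ := mul_one _
  have h2 : ∀ θ, ‖∫ φ in 0..(2 * π), kirchhoffIntegrand u β S θ φ‖ ≤
      (1 + 4 * S) * δ * (2 * π) := fun θ => by
    have := intervalIntegral.norm_integral_le_of_norm_le_const (a := 0) (b := 2 * π)
      (fun φ _ => hb θ φ)
    rwa [sub_zero, abs_of_pos two_pi_pos] at this
  have h3 := intervalIntegral.norm_integral_le_of_norm_le_const (a := 0) (b := π)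
    (fun θ _ => h2 θ)
  rw [kirchhoff hu hS hbox, sub_zero, abs_of_pos pi_pos, Real.norm_eq_abs, abs_mul,
    abs_of_pos (by positivity : (0 : ℝ) < 4 * π)] at h3
  -- Bounding `sin θ` by 1 replaces the area `4 π` by `2 π²`, hence the ratio `π / 2`, which is
  -- below 2.
  have h4 : |u β| ≤ (1 + 4 * S) * δ * (π / 2) := by
    have := pi_pos
    refine le_of_mul_le_mul_left (h3.trans (le_of_eq ?_)) (by positivity : (0 : ℝ) < 4 * π)
    ring
  refine h4.trans ?_
  have : 0 ≤ (1 + 4 * S) * δ := by positivity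
  nlinarith [pi_lt_four]

/-! ### Approximation by exponentials -/

section Exponentials

open MeasureTheory Real

/-- The exponential `β ↦ exp (a · β)` (Euclidean pairing). -/
def expFun (a β : Minkowski) : ℝ := exp (∑ μ, a μ * β μ)

lemma contDiff_expFun {n : WithTop ℕ∞} (a : Minkowski) : ContDiff ℝ n (expFun a) := by
  unfold expFun; fun_prop

lemma continuous_expFun (a : Minkowski) : Continuous (expFun a) :=
  (contDiff_expFun (n := 0) a).continuous

lemma expFun_add (a b β : Minkowski) : expFun (a + b) β = expFun a β * expFun b β := by
  simp only [expFun, ← exp_add, Pi.add_apply, add_mul, Finset.sum_add_distrib]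

lemma expFun_sub (a β y : Minkowski) : expFun a (β - y) = expFun a β * expFun (-a) y := by
  simp only [expFun, ← exp_add, ← Finset.sum_add_distrib, Pi.sub_apply, Pi.neg_apply]
  congr 1
  exact Finset.sum_congr rfl fun μ _ => by ring

lemma partialDown_expFun (a : Minkowski) (μ : Fin 4) (β : Minkowski) :
    partialDown μ (expFun a) β = a μ * expFun a β := by
  have h : ∀ ν : Fin 4, DifferentiableAt ℝ (fun b : Minkowski => b ν) β := fun ν => by fun_prop
  have hl : DifferentiableAt ℝ (fun b : Minkowski => ∑ ν, a ν * b ν) β :=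
    DifferentiableAt.fun_sum fun ν _ => (h ν).const_mul _
  have h2 : partialDown μ (fun b : Minkowski => ∑ ν, a ν * b ν) β = a μ := by
    rw [partialDown_sum _ (fun ν _ => (h ν).const_mul _)]
    simp_rw [partialDown_const_mul (h _), partialDown_coord]
    simp
  rw [partialDown] at h2 ⊢
  change (fderiv ℝ (fun b : Minkowski => exp (∑ ν, a ν * b ν)) β) _ = _
  rw [hl.hasFDerivAt.exp.fderiv, smul_apply, h2, smul_eq_mul, mul_comm]
  rfl

/-- **Stone–Weierstrass** for linear combinations of real exponentials. -/
lemma exists_expFun_near {K : Set Minkowski} (hK : IsCompact K) {f : Minkowski → ℝ}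
    (hf : Continuous f) {δ : ℝ} (hδ : 0 < δ) :
    ∃ c : Minkowski →₀ ℝ, ∀ x ∈ K, |c.sum (fun a w => w * expFun a x) - f x| < δ := by
  have := isCompact_iff_compactSpace.1 hK
  let e : Multiplicative Minkowski →* C(K, ℝ) :=
    { toFun := fun a => ⟨fun x => expFun a.toAdd x, (continuous_expFun _).comp continuous_subtype_val⟩
      map_one' := by ext x; simp [expFun]
      map_mul' := fun a b => by ext x; simp [expFun_add] }
  let A : Subalgebra ℝ C(K, ℝ) := Algebra.adjoin ℝ (Set.range e)
  have hA : A.SeparatesPoints := by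
    intro x y hxy
    obtain ⟨μ, hμ⟩ := Function.ne_iff.1 fun h : (x : Minkowski) = y => hxy (Subtype.ext h)
    refine ⟨_, ⟨e (Multiplicative.ofAdd (Pi.single μ 1)), Algebra.subset_adjoin ⟨_, rfl⟩, rfl⟩, ?_⟩
    simpa [e, expFun, Pi.single_apply] using hμ
  obtain ⟨g, hg⟩ := ContinuousMap.exists_mem_subalgebra_near_continuous_of_separatesPoints A hA
    (fun x : K => f x) (hf.comp continuous_subtype_val) δ hδ
  have hgm : (g : C(K, ℝ)) ∈ Submodule.span ℝ (Set.range e) := by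
    -- Products of exponentials are exponentials, so the range of `e` is already a submonoid and the
    -- algebra it generates is its linear span.
    have h1 := Algebra.adjoin_eq_span (R := ℝ) (s := Set.range e)
    rw [← MonoidHom.coe_mrange, Submonoid.closure_eq, MonoidHom.coe_mrange] at h1
    rw [← h1]
    exact g.2
  obtain ⟨c, hc⟩ := Finsupp.mem_span_range_iff_exists_finsupp.1 hgm
  refine ⟨c, fun x hx => ?_⟩
  have := hg ⟨x, hx⟩
  rw [← hc] at this
  simp only [Finsupp.sum, ContinuousMap.sum_apply, ContinuousMap.smul_apply, smul_eq_mul,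
    Real.norm_eq_abs] at this
  exact this

lemma integrable_expFun_mul {g : Minkowski → ℝ} (hg : Continuous g) (hc : HasCompactSupport g)
    (a : Minkowski) : Integrable (fun y => expFun a y * g y) :=
  ((continuous_expFun a).mul hg).integrable_of_hasCompactSupport hc.mul_left

/-- The exponential sum obtained by convolving `g` with `∑ w exp (a · β)`. -/
def expConv (c : Minkowski →₀ ℝ) (g : Minkowski → ℝ) (β : Minkowski) : ℝ :=
  c.sum fun a w => w * (∫ y, expFun (-a) y * g y) * expFun a β

lemma integral_mul_eq_expConv (c : Minkowski →₀ ℝ) {g : Minkowski → ℝ} (hg : Continuous g)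
    (hc : HasCompactSupport g) (β : Minkowski) :
    ∫ y, c.sum (fun a w => w * expFun a (β - y)) * g y = expConv c g β := by
  simp only [Finsupp.sum, expConv, Finset.sum_mul, expFun_sub]
  rw [integral_finsetSum]
  · refine Finset.sum_congr rfl fun a _ => ?_
    rw [mul_assoc, mul_comm (∫ y, _), ← integral_const_mul, ← integral_const_mul]
    refine integral_congr_ae (ae_of_all _ fun y => ?_)
    ring
  · intro a _
    have := (integrable_expFun_mul hg hc (-a)).const_mul (c a * expFun a β)
    refine this.congr (ae_of_all _ fun y => ?_)
    ring

/-- Integration by parts moves the factor `a μ` onto `g`. Hence one `c` that works for `g` and its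
derivatives approximates all of them by the derivatives of a single exponential sum. -/
lemma partialDown_expConv (c : Minkowski →₀ ℝ) {g : Minkowski → ℝ} (hg : ContDiff ℝ ∞ g)
    (hc : HasCompactSupport g) (μ : Fin 4) :
    partialDown μ (expConv c g) = expConv c (partialDown μ g) := by
  ext β
  have hd : ∀ a, DifferentiableAt ℝ (expFun a) β := fun a =>
    (contDiff_expFun (n := 1) a).differentiable (by simp) β
  have hparts : ∀ a, ∫ y, expFun (-a) y * partialDown μ g y = a μ * ∫ y, expFun (-a) y * g y := by
    intro a
    have hcp : HasCompactSupport (partialDown μ g) := hc.fderiv_apply ℝ _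
    have h1 := integral_mul_fderiv_eq_neg_fderiv_mul_of_integrable (μ := volume)
      (f := expFun (-a)) (g := g) (v := Pi.single μ (1 : ℝ)) ?_
      (integrable_expFun_mul (contDiff_partialDown hg μ).continuous hcp (-a))
      (integrable_expFun_mul hg.continuous hc (-a))
      (fun y _ => (contDiff_expFun (n := 1) (-a)).differentiable (by simp) y)
      (fun y _ => hg.differentiable (by simp) y)
    · change ∫ y, expFun (-a) y * partialDown μ g y =
        -∫ y, partialDown μ (expFun (-a)) y * g y at h1
      rw [h1, ← integral_const_mul, ← integral_neg]
      refine integral_congr_ae (ae_of_all _ fun y => ?_)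
      simp only [partialDown_expFun, Pi.neg_apply]
      ring
    · have := (integrable_expFun_mul hg.continuous hc (-a)).const_mul ((-a) μ)
      refine this.congr (ae_of_all _ fun y => ?_)
      change _ = partialDown μ (expFun (-a)) y * g y
      rw [partialDown_expFun]
      ring
  change partialDown μ (fun β => ∑ a ∈ c.support, c a * (∫ y, expFun (-a) y * g y) * expFun a β) β
    = _
  rw [partialDown_sum _ (fun a _ => (hd a).const_mul _)]
  refine Finset.sum_congr rfl fun a _ => ?_
  rw [partialDown_const_mul (hd a), partialDown_expFun]
  simp only [hparts]
  ring

/-- Finitely many continuous compactly supported functions are simultaneously approximated,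
uniformly on compact sets, by their convolutions with one exponential sum. -/
lemma exists_expConv_near {ι : Type*} [Finite ι] {g : ι → Minkowski → ℝ}
    (hg : ∀ i, Continuous (g i)) (hc : ∀ i, HasCompactSupport (g i)) {K : Set Minkowski}
    (hK : IsCompact K) {δ : ℝ} (hδ : 0 < δ) :
    ∃ c : Minkowski →₀ ℝ, ∀ i, ∀ β ∈ K, |g i β - expConv c (g i) β| ≤ δ := by
  cases nonempty_fintype ι
  have hρ : ∀ᶠ ρ in nhdsWithin (0 : ℝ) (Set.Ioi 0), ∀ i, ∀ x y, dist x y < ρ →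
      dist (g i x) (g i y) < δ / 2 := by
    rw [Filter.eventually_all]
    intro i
    have hu := (hg i).uniformContinuous_of_tendsto_cocompact (hc i).is_zero_at_infty
    obtain ⟨ρ, hρ, h⟩ := Metric.uniformContinuous_iff.1 hu (δ / 2) (half_pos hδ)
    filter_upwards [Ioo_mem_nhdsGT hρ] with r hr x y hxy
    exact h (hxy.trans hr.2)
  obtain ⟨ρ, hρ, hρ0⟩ := (hρ.and self_mem_nhdsWithin).exists
  have hρ0 : 0 < ρ := hρ0
  let φ : ContDiffBump (0 : Minkowski) := ⟨ρ / 2, ρ, half_pos hρ0, half_lt_self hρ0⟩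
  let k : Minkowski → ℝ := φ.normed volume
  have hk : Continuous k := φ.continuous_normed
  -- The kernel `k` is evaluated only at differences of points of `K` and points of the supports, so
  -- the exponential sum need only approximate it there.
  let K' : Set Minkowski := ⋃ i, (fun q : Minkowski × Minkowski => q.1 - q.2) '' (K ×ˢ tsupport (g i))
  have hK' : IsCompact K' := isCompact_iUnion fun i =>
    (hK.prod (hc i)).image (continuous_fst.sub continuous_snd)
  let N : ℝ := ∑ i, ∫ y, |g i y|
  have hgi : ∀ i, Integrable (g i) := fun i => (hg i).integrable_of_hasCompactSupport (hc i)
  have hNi : ∀ i, ∫ y, |g i y| ≤ N := fun i =>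
    Finset.single_le_sum (f := fun i => ∫ y, |g i y|)
      (fun j _ => integral_nonneg fun y => abs_nonneg _) (Finset.mem_univ i)
  have hN : 0 ≤ N := Finset.sum_nonneg fun j _ => integral_nonneg fun y => abs_nonneg _
  -- Integrated against `|g i|`, of total mass at most `N`, this error contributes at most `δ / 2`;
  -- mollification by the bump contributes the other half.
  obtain ⟨c, hcK⟩ := exists_expFun_near hK' hk (δ := δ / 2 / (N + 1)) (by positivity)
  refine ⟨c, fun i β hβ => ?_⟩
  have h1 := φ.dist_normed_convolution_le (μ := volume) (g := g i) (x₀ := β) (ε := δ / 2)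
    (hg i).aestronglyMeasurable (fun x hx => (hρ i x β hx).le)
  rw [convolution_lsmul_swap, Real.dist_eq, abs_sub_comm] at h1
  simp only [smul_eq_mul] at h1
  have hs : Continuous fun y => c.sum fun a w => w * expFun a (β - y) := by
    unfold Finsupp.sum
    exact continuous_finsetSum _ fun a _ => continuous_const.mul
      ((continuous_expFun a).comp (continuous_const.sub continuous_id))
  have hki : Integrable fun y => k (β - y) * g i y :=
    ((hk.comp (continuous_const.sub continuous_id)).mul (hg i)).integrable_of_hasCompactSupport
      (hc i).mul_left
  have hsi : Integrable fun y => c.sum (fun a w => w * expFun a (β - y)) * g i y :=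
    (hs.mul (hg i)).integrable_of_hasCompactSupport (hc i).mul_left
  have h2 : |(∫ y, k (β - y) * g i y) - expConv c (g i) β| ≤ δ / 2 := by
    rw [← integral_mul_eq_expConv c (hg i) (hc i), ← integral_sub hki hsi]
    have h3 : ∀ y, ‖k (β - y) * g i y - c.sum (fun a w => w * expFun a (β - y)) * g i y‖ ≤
        δ / 2 / (N + 1) * |g i y| := by
      intro y
      rw [← sub_mul, Real.norm_eq_abs, abs_mul]
      by_cases hy : y ∈ tsupport (g i)
      · refine mul_le_mul_of_nonneg_right ?_ (abs_nonneg _)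
        rw [abs_sub_comm]
        exact (hcK _ (Set.mem_iUnion.2 ⟨i, (β, y), ⟨hβ, hy⟩, rfl⟩)).le
      · simp [image_eq_zero_of_notMem_tsupport hy]
    refine (norm_integral_le_of_norm_le ((hgi i).abs.const_mul _) (ae_of_all _ h3)).trans ?_
    rw [integral_const_mul]
    refine (mul_le_mul_of_nonneg_left (hNi i) (by positivity)).trans ?_
    rw [div_mul_eq_mul_div, div_le_iff₀ (by positivity)]
    nlinarith
  have := abs_sub_le (g i β) (∫ y, k (β - y) * g i y) (expConv c (g i) β)
  linarith

end Exponentials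

/-! ### Density of plane waves -/

section PlaneWaves

/-- The span of the plane waves `β ↦ f (n · β)`, `n` future-directed and null. -/
def planeWaves : Submodule ℝ (Minkowski → ℝ) :=
  Submodule.span ℝ {P | ∃ n : Minkowski, ∃ f : ℝ → ℝ, IsFutureNull n ∧ ContDiff ℝ ∞ f ∧
    P = fun β => f (mdot n β)}

lemma planeWave_mem {n : Minkowski} (hn : IsFutureNull n) {f : ℝ → ℝ} (hf : ContDiff ℝ ∞ f) :
    (fun β => f (mdot n β)) ∈ planeWaves :=
  Submodule.subset_span ⟨n, f, hn, hf, rfl⟩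

lemma partialDown_comp_mdot {f : ℝ → ℝ} {n β : Minkowski} (hf : DifferentiableAt ℝ f (mdot n β))
    (μ : Fin 4) :
    partialDown μ (fun b => f (mdot n b)) β = deriv f (mdot n β) * (eta μ * n μ) := by
  have hd : DifferentiableAt ℝ (mdot n) β := (contDiff_mdot (n := 1) n).differentiable (by simp) β
  have h := hf.hasDerivAt.comp_hasFDerivAt β hd.hasFDerivAt
  have h2 := partialDown_mdot n μ β
  rw [partialDown] at h2
  rw [partialDown]
  change (fderiv ℝ (f ∘ mdot n) β) _ = _
  rw [h.fderiv, smul_apply, h2, smul_eq_mul]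

lemma differentiableAt_comp_mdot {f : ℝ → ℝ} (hf : ContDiff ℝ ∞ f) (n β : Minkowski) :
    DifferentiableAt ℝ (fun b => f (mdot n b)) β :=
  (hf.comp (contDiff_mdot n)).differentiable (by simp) β

lemma contDiff_deriv_top {f : ℝ → ℝ} (hf : ContDiff ℝ ∞ f) : ContDiff ℝ ∞ (deriv f) :=
  (contDiff_infty_iff_deriv.1 hf).2

/-- The wave operator produces `f''` times `sq n`. -/
lemma box_comp_mdot {f : ℝ → ℝ} (hf : ContDiff ℝ ∞ f) {n : Minkowski} (hn : IsFutureNull n)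
    (β : Minkowski) : box (fun b => f (mdot n b)) β = 0 := by
  have hs : ContDiff ℝ ∞ (fun b => f (mdot n b)) := hf.comp (contDiff_mdot n)
  have hf' := contDiff_deriv_top hf
  rw [box_eq_sum hs.contDiffAt]
  have h1 : ∀ μ, partialDown μ (fun b => f (mdot n b)) =
      fun b => (eta μ * n μ) * deriv f (mdot n b) := fun μ => by
    ext b
    rw [partialDown_comp_mdot (hf.differentiable (by simp) _), mul_comm]
  have h2 : ∀ μ, eta μ • partialDown μ (partialDown μ (fun b => f (mdot n b))) β =
      deriv (deriv f) (mdot n β) * (eta μ * n μ ^ 2) := fun μ => by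
    rw [h1, partialDown_const_mul (differentiableAt_comp_mdot hf' n β),
      partialDown_comp_mdot (hf'.differentiable (by simp) _), smul_eq_mul]
    linear_combination (eta μ * n μ ^ 2 * deriv (deriv f) (mdot n β)) * eta_mul_self μ
  rw [Finset.sum_congr rfl fun μ _ => h2 μ, ← Finset.mul_sum]
  change _ * sq n = 0
  rw [hn.2, mul_zero]

lemma box_add {f g : Minkowski → ℝ} (hf : ContDiff ℝ ∞ f) (hg : ContDiff ℝ ∞ g) (β : Minkowski) :
    box (fun b => f b + g b) β = box f β + box g β := by
  rw [box_eq_sum (hf.add hg).contDiffAt, box_eq_sum hf.contDiffAt, box_eq_sum hg.contDiffAt,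
    ← Finset.sum_add_distrib]
  refine Finset.sum_congr rfl fun μ _ => ?_
  have h1 : partialDown μ (fun b => f b + g b) = fun b => partialDown μ f b + partialDown μ g b := by
    ext b
    exact partialDown_add (hf.differentiable (by simp) b) (hg.differentiable (by simp) b) μ
  rw [h1, partialDown_add ((contDiff_partialDown hf μ).differentiable (by simp) _)
    ((contDiff_partialDown hg μ).differentiable (by simp) _), smul_add]

lemma box_const_mul {f : Minkowski → ℝ} (hf : ContDiff ℝ ∞ f) (c : ℝ) (β : Minkowski) :
    box (fun b => c * f b) β = c * box f β := by
  rw [box_eq_sum (contDiff_const.mul hf).contDiffAt, box_eq_sum hf.contDiffAt, Finset.mul_sum]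
  refine Finset.sum_congr rfl fun μ _ => ?_
  have h1 : partialDown μ (fun b => c * f b) = fun b => c * partialDown μ f b := by
    ext b
    exact partialDown_const_mul (hf.differentiable (by simp) b) c μ
  rw [h1, partialDown_const_mul ((contDiff_partialDown hf μ).differentiable (by simp) _),
    smul_eq_mul, smul_eq_mul]
  ring

lemma contDiff_and_box_of_mem_planeWaves {P : Minkowski → ℝ} (hP : P ∈ planeWaves) :
    ContDiff ℝ ∞ P ∧ ∀ β, box P β = 0 := by
  induction hP using Submodule.span_induction with
  | mem P h =>
    obtain ⟨n, f, hn, hf, rfl⟩ := h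
    exact ⟨hf.comp (contDiff_mdot n), box_comp_mdot hf hn⟩
  | zero =>
    refine ⟨contDiff_const, fun β => ?_⟩
    have := box_const_mul (f := fun _ => (0 : ℝ)) contDiff_const 0 β
    simp only [zero_mul] at this
    exact this
  | add P Q _ _ hP hQ =>
    refine ⟨hP.1.add hQ.1, fun β => ?_⟩
    have := box_add hP.1 hQ.1 β
    rw [hP.2, hQ.2, add_zero] at this
    exact this
  | smul c P _ hP =>
    refine ⟨contDiff_const.mul hP.1, fun β => ?_⟩
    have := box_const_mul hP.1 c β
    rw [hP.2, mul_zero] at this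
    exact this

open Real in
/-- An exponential has the same Cauchy data on `{β⁰ = T}` as some sum of plane waves. -/
lemma exists_planeWave_data (a : Minkowski) (T : ℝ) :
    ∃ P ∈ planeWaves, ∀ β, β 0 = T →
      P β = expFun a β ∧ partialDown 0 P β = a 0 * expFun a β := by
  have hE : ∀ β : Minkowski, β 0 = T → expFun a β =
      exp (a 0 * T) * exp (a 1 * β 1 + a 2 * β 2 + a 3 * β 3) := fun β hβ => by
    rw [expFun, Fin.sum_univ_four, hβ, ← exp_add]
    congr 1
    ring
  obtain ⟨k, hk0, hk⟩ : ∃ k : ℝ, 0 ≤ k ∧ k ^ 2 = a 1 ^ 2 + a 2 ^ 2 + a 3 ^ 2 :=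
    ⟨√(a 1 ^ 2 + a 2 ^ 2 + a 3 ^ 2), sqrt_nonneg _, sq_sqrt (by positivity)⟩
  have key : ∀ (n m : Minkowski) (f g : ℝ → ℝ), IsFutureNull n → IsFutureNull m →
      ContDiff ℝ ∞ f → ContDiff ℝ ∞ g →
      (∀ β : Minkowski, β 0 = T → f (mdot n β) + g (mdot m β) = expFun a β ∧
        n 0 * deriv f (mdot n β) + m 0 * deriv g (mdot m β) = a 0 * expFun a β) →
      ∃ P ∈ planeWaves, ∀ β, β 0 = T →
        P β = expFun a β ∧ partialDown 0 P β = a 0 * expFun a β := by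
    intro n m f g hn hm hf hg h
    refine ⟨_, planeWaves.add_mem (planeWave_mem hn hf) (planeWave_mem hm hg), fun β hβ => ?_⟩
    refine ⟨(h β hβ).1, ?_⟩
    rw [← (h β hβ).2]
    change partialDown 0 (fun b => f (mdot n b) + g (mdot m b)) β = _
    rw [partialDown_add (differentiableAt_comp_mdot hf n β) (differentiableAt_comp_mdot hg m β),
      partialDown_comp_mdot (hf.differentiable (by simp) _),
      partialDown_comp_mdot (hg.differentiable (by simp) _)]
    simp [eta]
    ring
  rcases hk0.eq_or_lt with h0 | h0
  -- Without spatial dependence the solution is affine in time. The two opposite null directions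
  -- each carry half of it, and their dependence on `β 1` cancels.
  · rw [← h0] at hk
    have h1 : a 1 = 0 := by nlinarith [sq_nonneg (a 1), sq_nonneg (a 2), sq_nonneg (a 3)]
    have h2 : a 2 = 0 := by nlinarith [sq_nonneg (a 1), sq_nonneg (a 2), sq_nonneg (a 3)]
    have h3 : a 3 = 0 := by nlinarith [sq_nonneg (a 1), sq_nonneg (a 2), sq_nonneg (a 3)]
    have hd : ∀ y : ℝ, HasDerivAt (fun x => exp (a 0 * T) * (2⁻¹ + a 0 * (x - T) / 2))
        (exp (a 0 * T) * (a 0 / 2)) y := fun y => by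
      simpa using (((((hasDerivAt_id y).sub_const T).const_mul (a 0)).div_const 2).const_add
        2⁻¹).const_mul (exp (a 0 * T))
    refine key ![1, 1, 0, 0] ![1, -1, 0, 0] (fun x => exp (a 0 * T) * (2⁻¹ + a 0 * (x - T) / 2))
      (fun x => exp (a 0 * T) * (2⁻¹ + a 0 * (x - T) / 2)) ⟨by simp, by simp [sq_eq]⟩
      ⟨by simp, by simp [sq_eq]⟩ (by fun_prop) (by fun_prop) fun β hβ => ?_
    rw [hE β hβ, (hd _).deriv, (hd _).deriv, h1, h2, h3]
    simp only [mdot_eq, Matrix.cons_val, hβ]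
    simp
    constructor <;> ring
  -- With `x` the spatial part of `β`, the waves `exp (±k (β⁰ - T) + a · x)` both equal `exp (a ·
  -- x)` on the slice. The amplitudes `(1 ± a 0 / k) / 2` sum to 1 and give the time derivative `a
  -- 0`.
  · have hd1 : ∀ y : ℝ, HasDerivAt (fun x => exp (a 0 * T) * ((1 + a 0 / k) / 2) * exp (x - k * T))
        (exp (a 0 * T) * ((1 + a 0 / k) / 2) * exp (y - k * T)) y := fun y => by
      simpa using (((hasDerivAt_id y).sub_const (k * T)).exp).const_mul
        (exp (a 0 * T) * ((1 + a 0 / k) / 2))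
    have hd2 : ∀ y : ℝ, HasDerivAt (fun x => exp (a 0 * T) * ((1 - a 0 / k) / 2) * exp (k * T - x))
        (exp (a 0 * T) * ((1 - a 0 / k) / 2) * -exp (k * T - y)) y := fun y => by
      simpa using (((hasDerivAt_id y).const_sub (k * T)).exp).const_mul
        (exp (a 0 * T) * ((1 - a 0 / k) / 2))
    refine key ![k, -a 1, -a 2, -a 3] ![k, a 1, a 2, a 3]
      (fun x => exp (a 0 * T) * ((1 + a 0 / k) / 2) * exp (x - k * T))
      (fun x => exp (a 0 * T) * ((1 - a 0 / k) / 2) * exp (k * T - x))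
      ⟨by simpa using h0, by simp only [sq_eq, Matrix.cons_val]; linarith⟩
      ⟨by simpa using h0, by simp only [sq_eq, Matrix.cons_val]; linarith⟩
      (by fun_prop) (by fun_prop) fun β hβ => ?_
    rw [hE β hβ, (hd1 _).deriv, (hd2 _).deriv]
    simp only [mdot_eq, Matrix.cons_val, hβ]
    rw [show k * T - -a 1 * β 1 - -a 2 * β 2 - -a 3 * β 3 - k * T =
      a 1 * β 1 + a 2 * β 2 + a 3 * β 3 by ring,
      show k * T - (k * T - a 1 * β 1 - a 2 * β 2 - a 3 * β 3) =
      a 1 * β 1 + a 2 * β 2 + a 3 * β 3 by ring]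
    constructor <;> field_simp <;> ring

lemma contDiff_expConv (c : Minkowski →₀ ℝ) (g : Minkowski → ℝ) : ContDiff ℝ ∞ (expConv c g) := by
  have := fun a => contDiff_expFun (n := ∞) a
  unfold expConv Finsupp.sum
  fun_prop

lemma exists_planeWaves_data_expConv (c : Minkowski →₀ ℝ) (g : Minkowski → ℝ) (T : ℝ) :
    ∃ P ∈ planeWaves, ∀ β, β 0 = T →
      P β = expConv c g β ∧ partialDown 0 P β = partialDown 0 (expConv c g) β := by
  choose P hP hdata using fun a => exists_planeWave_data a T
  let w : Minkowski → ℝ := fun a => c a * ∫ y, expFun (-a) y * g y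
  have hP' := fun a => (contDiff_and_box_of_mem_planeWaves (hP a)).1
  refine ⟨fun β => ∑ a ∈ c.support, w a * P a β, ?_, fun β hβ => ⟨?_, ?_⟩⟩
  · have : (fun β => ∑ a ∈ c.support, w a * P a β) = ∑ a ∈ c.support, w a • P a := by
      ext β; simp
    rw [this]
    exact Submodule.sum_mem _ fun a _ => Submodule.smul_mem _ _ (hP a)
  · exact Finset.sum_congr rfl fun a _ => by rw [(hdata a β hβ).1]
  · have h1 : ∀ a, DifferentiableAt ℝ (P a) β := fun a => (hP' a).differentiable (by simp) β
    have h2 : ∀ a, DifferentiableAt ℝ (expFun a) β := fun a =>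
      (contDiff_expFun (n := 1) a).differentiable (by simp) β
    change _ = partialDown 0 (fun β => ∑ a ∈ c.support, w a * expFun a β) β
    rw [partialDown_sum _ fun a _ => (h1 a).const_mul _,
      partialDown_sum _ fun a _ => (h2 a).const_mul _]
    refine Finset.sum_congr rfl fun a _ => ?_
    rw [partialDown_const_mul (h1 a), partialDown_const_mul (h2 a), (hdata a β hβ).2,
      partialDown_expFun]

/-- Tangential derivatives of a function vanishing on a time slice vanish there. -/
lemma partialDown_eq_zero_of_slice {f : Minkowski → ℝ} {β : Minkowski} {T : ℝ}
    (hf : DifferentiableAt ℝ f β) (h : ∀ b : Minkowski, b 0 = T → f b = 0) (hβ : β 0 = T)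
    {j : Fin 4} (hj : j ≠ 0) : partialDown j f β = 0 := by
  have hc : HasDerivAt (fun t : ℝ => β + t • Pi.single j (1 : ℝ)) (Pi.single j 1) 0 := by
    simpa using ((hasDerivAt_id (0 : ℝ)).smul_const (Pi.single j (1 : ℝ))).const_add β
  have h1 := HasFDerivAt.comp_hasDerivAt (x := (0 : ℝ)) (f := fun t : ℝ => β + t • Pi.single j (1 : ℝ))
    (l := f) (l' := fderiv ℝ f β) (f' := Pi.single j (1 : ℝ)) (by simpa using hf.hasFDerivAt) hc
  have h2 : f ∘ (fun t : ℝ => β + t • Pi.single j (1 : ℝ)) = fun _ => 0 := by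
    ext t
    exact h _ (by simp [hβ, hj.symm])
  rw [h2] at h1
  exact h1.unique (hasDerivAt_const _ _)

/-- The wave operator commutes with `∂_μ`. Since the equation is differentiated, it must hold near
`β`. This lets Kirchhoff's bound apply to derivatives of the error as well. -/
lemma box_partialDown_eq_zero {w : Minkowski → ℝ} (hw : ContDiff ℝ ∞ w) {β : Minkowski}
    (h : ∀ᶠ b in nhds β, box w b = 0) (μ : Fin 4) : box (partialDown μ w) β = 0 := by
  have hμ := fun ν => contDiff_partialDown hw ν
  have hd : ∀ ν, DifferentiableAt ℝ (partialDown ν (partialDown ν w)) β := fun ν =>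
    (contDiff_partialDown (hμ ν) ν).differentiable (by simp) β
  have h1 : partialDown μ (box w) β = 0 := by
    rw [partialDown_congr (g := fun _ => 0) h]
    simp [partialDown]
  have h2 : box w = fun b => ∑ ν, eta ν * partialDown ν (partialDown ν w) b := by
    ext b; rw [box_eq_sum hw.contDiffAt]; rfl
  rw [h2, partialDown_sum _ fun ν _ => (hd ν).const_mul _] at h1
  rw [box_eq_sum (hμ μ).contDiffAt, ← h1]
  refine Finset.sum_congr rfl fun ν _ => ?_
  rw [partialDown_const_mul (hd ν), smul_eq_mul,
    partialDown_comm (hμ ν).contDiffAt μ ν]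
  have : partialDown ν (partialDown μ w) = partialDown μ (partialDown ν w) := by
    ext b; exact partialDown_comm hw.contDiffAt ν μ
  rw [this]

/-- Future null vectors normalized by `n⁰ = 1`. -/
def nullSphere : Set Minkowski := {n | n 0 = 1 ∧ sq n = 0}

lemma isCompact_nullSphere : IsCompact nullSphere := by
  refine Metric.isCompact_of_isClosed_isBounded ?_ ?_
  · exact (isClosed_eq (continuous_apply 0) continuous_const).inter
      (isClosed_eq (contDiff_sq (n := 0)).continuous continuous_const)
  · refine (Metric.isBounded_closedBall (x := (0 : Minkowski)) (r := 1)).subset fun n hn => ?_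
    obtain ⟨h0, h⟩ := hn
    rw [sq_eq, h0] at h
    rw [mem_closedBall_zero_iff, pi_norm_le_iff_of_nonneg zero_le_one]
    intro i
    rw [Real.norm_eq_abs, ← sq_le_one_iff_abs_le_one]
    have h1 := sq_nonneg (n 1)
    have h2 := sq_nonneg (n 2)
    have h3 := sq_nonneg (n 3)
    fin_cases i <;> simp only [Fin.zero_eta, Fin.mk_one, Fin.reduceFinMk, h0] <;> linarith

lemma nullDir_mem_nullSphere (θ φ : ℝ) : nullDir θ φ ∈ nullSphere :=
  ⟨by simp [nullDir], (isFutureNull_nullDir θ φ).2⟩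

/-- A function smooth on the forward cone agrees near any compact subset with a smooth compactly
supported function. -/
lemma exists_compactly_supported_extension {Ψ : Minkowski → ℝ}
    (hΨ : ContDiffOn ℝ ∞ Ψ forwardCone) {C : Set Minkowski} (hC : IsCompact C)
    (hCV : C ⊆ forwardCone) :
    ∃ u : Minkowski → ℝ, ContDiff ℝ ∞ u ∧ HasCompactSupport u ∧
      ∀ b ∈ C, ∀ᶠ x in nhds b, u x = Ψ x := by
  obtain ⟨t, ht, hCt, htV⟩ := exists_compact_between hC isOpen_forwardCone hCV
  obtain ⟨χ, hχ1, hχ0, -⟩ := exists_contMDiffMap_one_nhds_of_subset_interior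
    (n := (⊤ : ℕ∞)) (modelWithCornersSelf ℝ Minkowski) hC.isClosed hCt
  have hχ : ContDiff ℝ ∞ χ := χ.contMDiff.contDiff
  refine ⟨fun b => χ b * Ψ b, contDiff_iff_contDiffAt.2 fun b => ?_, ?_, fun b hb => ?_⟩
  · by_cases hb : b ∈ forwardCone
    · exact hχ.contDiffAt.mul (hΨ.contDiffAt (isOpen_forwardCone.mem_nhds hb))
    · have : (fun b => χ b * Ψ b) =ᶠ[nhds b] fun _ => 0 := by
        filter_upwards [ht.isClosed.isOpen_compl.mem_nhds fun h => hb (htV h)] with x hx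
        rw [hχ0 x hx, zero_mul]
      exact contDiffAt_const.congr_of_eventuallyEq this
  · exact HasCompactSupport.intro ht fun x hx => by rw [hχ0 x hx, zero_mul]
  · filter_upwards [(eventually_nhdsSet_iff_forall.1 hχ1) b hb] with x hx
    rw [hx, one_mul]

/-- **Density of plane waves**: on a compact subset of the forward cone, every smooth solution of
the wave equation is a `C¹`-limit of sums of plane waves. -/
theorem exists_planeWaves_near {Ψ : Minkowski → ℝ} (hΨ : IsSmoothWaveSolution Ψ)
    {B : Set Minkowski} (hB : IsCompact B) (hBV : B ⊆ forwardCone) {ε : ℝ} (hε : 0 < ε) :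
    ∃ P ∈ planeWaves, ∀ β ∈ B, |Ψ β - P β| ≤ ε ∧
      ∀ μ, |partialDown μ Ψ β - partialDown μ P β| ≤ ε := by
  obtain ⟨T, hT0, hT⟩ : ∃ T : ℝ, 0 ≤ T ∧ ∀ β ∈ B, β 0 ≤ T := by
    obtain ⟨R, hR⟩ := hB.isBounded.exists_norm_le
    exact ⟨max R 0, le_max_right _ _, fun β hβ =>
      ((le_abs_self _).trans (norm_le_pi_norm β 0)).trans ((hR β hβ).trans (le_max_left _ _))⟩
  -- A compact set containing every forward null segment from `B` up to the slice `β⁰ = T`. Segments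
  -- running past the slice do no harm, as they stay in the forward cone.
  let C : Set Minkowski := (fun q : Minkowski × ℝ × Minkowski => q.1 + q.2.1 • q.2.2) ''
    (B ×ˢ Set.Icc 0 T ×ˢ nullSphere)
  have hC : IsCompact C :=
    (hB.prod (isCompact_Icc.prod isCompact_nullSphere)).image (by fun_prop)
  have hmem : ∀ β ∈ B, ∀ s, 0 ≤ s → s ≤ T - β 0 → ∀ θ φ, β + s • nullDir θ φ ∈ C :=
    fun β hβ s h0 h1 θ φ => ⟨(β, s, nullDir θ φ),
      ⟨hβ, ⟨h0, h1.trans (by linarith [(hBV hβ).1])⟩, nullDir_mem_nullSphere θ φ⟩, rfl⟩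
  have hCV : C ⊆ forwardCone := by
    rintro _ ⟨⟨β, s, n⟩, ⟨hβ, hs, hn⟩, rfl⟩
    exact add_smul_null_mem ⟨by rw [hn.1]; exact one_pos, hn.2⟩ (hBV hβ) hs.1
  have hBC : B ⊆ C := fun β hβ => by
    simpa using hmem β hβ 0 le_rfl (sub_nonneg.2 (hT β hβ)) 0 0
  obtain ⟨u, hu, hus, huΨ⟩ := exists_compactly_supported_extension hΨ.smooth hC hCV
  have hubox : ∀ b ∈ C, ∀ᶠ x in nhds b, box u x = 0 := by
    intro b hb
    filter_upwards [(huΨ b hb).eventually_nhds, isOpen_forwardCone.mem_nhds (hCV hb)] with x hx hxV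
    have hx' : ∀ μ, partialDown μ (partialDown μ u) x = partialDown μ (partialDown μ Ψ) x :=
      fun μ => partialDown_congr (hx.eventually_nhds.mono fun y hy => partialDown_congr hy μ) μ
    rw [box_eq_sum hu.contDiffAt, ← hΨ.wave x hxV, box_eq_sum (hΨ.contDiffAt hxV)]
    simp_rw [hx']
  have hu1 := fun μ => contDiff_partialDown hu μ
  have hu2 := fun μ ν => contDiff_partialDown (hu1 μ) ν
  have hs1 : ∀ μ, HasCompactSupport (partialDown μ u) := fun μ => hus.fderiv_apply ℝ _
  have hs2 : ∀ μ ν, HasCompactSupport (partialDown ν (partialDown μ u)) := fun μ ν =>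
    (hs1 μ).fderiv_apply ℝ _
  -- The data of the error will be bounded by `3 * δ`, and Kirchhoff's bound multiplies this by at
  -- most `2 * (1 + 4 * T)`.
  let δ : ℝ := ε / (6 * (1 + 4 * T))
  have hδ : 0 < δ := by positivity
  obtain ⟨c, hc⟩ := exists_expConv_near
    (g := Sum.elim (fun _ : Unit => u) (Sum.elim (fun μ => partialDown μ u)
      (fun q : Fin 4 × Fin 4 => partialDown q.2 (partialDown q.1 u))))
    (by rintro (_ | _ | _) <;> simp [hu.continuous, (hu1 _).continuous, (hu2 _ _).continuous])
    (by rintro (_ | _ | _) <;> simp [hus, hs1, hs2]) hC hδ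
  set E := expConv c u with hEdef
  have hE : ContDiff ℝ ∞ E := contDiff_expConv c u
  obtain ⟨P, hP, hPdata⟩ := exists_planeWaves_data_expConv c u T
  simp only [← hEdef] at hPdata
  obtain ⟨hPs, hPbox⟩ := contDiff_and_box_of_mem_planeWaves hP
  have hE1 : ∀ μ, partialDown μ E = expConv c (partialDown μ u) := fun μ =>
    partialDown_expConv c hu hus μ
  have hE2 : ∀ μ ν, partialDown ν (partialDown μ E) = expConv c (partialDown ν (partialDown μ u)) :=
    fun μ ν => by rw [hE1, partialDown_expConv c (hu1 μ) (hs1 μ)]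
  have b0 : ∀ b ∈ C, |u b - E b| ≤ δ := fun b hb => hc (Sum.inl ()) b hb
  have b1 : ∀ b ∈ C, ∀ μ, |partialDown μ u b - partialDown μ E b| ≤ δ := fun b hb μ => by
    rw [hE1]; exact hc (Sum.inr (Sum.inl μ)) b hb
  have b2 : ∀ b ∈ C, ∀ μ ν, |partialDown ν (partialDown μ u) b -
      partialDown ν (partialDown μ E) b| ≤ δ := fun b hb μ ν => by
    rw [hE2]; exact hc (Sum.inr (Sum.inr (μ, ν))) b hb
  have hE1s := fun μ => contDiff_partialDown hE μ
  have hP1s := fun μ => contDiff_partialDown hPs μ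
  have dd : ∀ {f : Minkowski → ℝ}, ContDiff ℝ ∞ f → ∀ b, DifferentiableAt ℝ f b :=
    fun hf b => hf.differentiable (by simp) b
  -- `P` and `E` agree on the slice together with the derivatives that enter below
  have s1 : ∀ μ, ∀ b : Minkowski, b 0 = T → partialDown μ E b = partialDown μ P b := by
    intro μ b hb
    by_cases hμ : μ = 0
    · rw [hμ, (hPdata b hb).2]
    · rw [← sub_eq_zero, ← partialDown_sub (dd hE b) (dd hPs b)]
      exact partialDown_eq_zero_of_slice ((dd hE b).fun_sub (dd hPs b))
        (fun x hx => by rw [(hPdata x hx).1, sub_self]) hb hμ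
  have s2 : ∀ μ ν, ν ≠ 0 → ∀ b : Minkowski, b 0 = T →
      partialDown ν (partialDown μ E) b = partialDown ν (partialDown μ P) b := by
    intro μ ν hν b hb
    rw [← sub_eq_zero, ← partialDown_sub (dd (hE1s μ) b) (dd (hP1s μ) b)]
    exact partialDown_eq_zero_of_slice ((dd (hE1s μ) b).fun_sub (dd (hP1s μ) b))
      (fun x hx => by rw [s1 μ x hx, sub_self]) hb hν
  -- The error solves the wave equation near `C`. The exponential sum `E` need not be a solution; it
  -- only serves to compare `u` with `P` on the slice.
  let w : Minkowski → ℝ := fun b => u b - P b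
  have hw : ContDiff ℝ ∞ w := hu.sub hPs
  have hw1s := fun μ => contDiff_partialDown hw μ
  have hw1 : ∀ μ, partialDown μ w = fun b => partialDown μ u b - partialDown μ P b := fun μ => by
    ext b; exact partialDown_sub (dd hu b) (dd hPs b) μ
  have hw2 : ∀ μ ν b, partialDown ν (partialDown μ w) b =
      partialDown ν (partialDown μ u) b - partialDown ν (partialDown μ P) b := fun μ ν b => by
    rw [hw1, partialDown_sub (dd (hu1 μ) b) (dd (hP1s μ) b)]
  have hwbox : ∀ b ∈ C, ∀ᶠ x in nhds b, box w x = 0 := by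
    intro b hb
    filter_upwards [hubox b hb] with x hx
    have h := hPbox x
    rw [box_eq_sum hu.contDiffAt] at hx
    rw [box_eq_sum hPs.contDiffAt] at h
    rw [box_eq_sum hw.contDiffAt]
    simp_rw [hw2, smul_sub]
    rw [Finset.sum_sub_distrib, hx, h, sub_zero]
  have c0 : ∀ b ∈ C, b 0 = T → |w b| ≤ 3 * δ := fun b hb hbT => by
    have := b0 b hb
    rw [← (hPdata b hbT).1] at this
    exact this.trans (by linarith)
  have c1 : ∀ μ, ∀ b ∈ C, b 0 = T → |partialDown μ w b| ≤ 3 * δ := fun μ b hb hbT => by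
    have := b1 b hb μ
    rw [s1 μ b hbT] at this
    rw [hw1]
    exact this.trans (by linarith)
  have c2' : ∀ μ ν, ν ≠ 0 → ∀ b ∈ C, b 0 = T → |partialDown ν (partialDown μ w) b| ≤ δ :=
    fun μ ν hν b hb hbT => by
      have := b2 b hb μ ν
      rwa [s2 μ ν hν b hbT, ← hw2] at this
  have c2 : ∀ μ ν, ∀ b ∈ C, b 0 = T → |partialDown ν (partialDown μ w) b| ≤ 3 * δ := by
    intro μ ν b hb hbT
    by_cases hν : ν = 0
    · by_cases hμ : μ = 0
      -- The second time derivatives of `E` and `P` may differ on the slice. That of `w` is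
      -- recovered from the wave equation as a sum of three spatial ones, whence the factor 3.
      · have hx := (hwbox b hb).self_of_nhds
        rw [box_eq_sum hw.contDiffAt, Fin.sum_univ_four] at hx
        simp [eta] at hx
        have h1 := abs_le.1 (c2' 1 1 (by decide) b hb hbT)
        have h2 := abs_le.1 (c2' 2 2 (by decide) b hb hbT)
        have h3 := abs_le.1 (c2' 3 3 (by decide) b hb hbT)
        rw [hμ, hν, abs_le]
        constructor <;> linarith
      · rw [partialDown_comm hw.contDiffAt]
        exact (c2' ν μ hμ b hb hbT).trans (by linarith)
    · exact (c2' μ ν hν b hb hbT).trans (by linarith)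
  refine ⟨P, hP, fun β hβ => ?_⟩
  have hS : 0 ≤ T - β 0 := sub_nonneg.2 (hT β hβ)
  have hmemS := fun θ φ => hmem β hβ (T - β 0) hS le_rfl θ φ
  have hST : ∀ θ φ, (β + (T - β 0) • nullDir θ φ) 0 = T := fun θ φ => by simp [nullDir]
  have hfin : 2 * (1 + 4 * (T - β 0)) * (3 * δ) ≤ ε := by
    have h1 : 6 * (1 + 4 * T) * δ = ε := mul_div_cancel₀ _ (by positivity)
    have := (hBV hβ).1
    nlinarith
  refine ⟨?_, fun μ => ?_⟩
  · rw [← (huΨ β (hBC hβ)).self_of_nhds]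
    refine (abs_le_of_kirchhoff hw hS (fun s h0 h1 θ φ => ?_)
      (fun θ φ => c0 _ (hmemS θ φ) (hST θ φ))
      (fun θ φ μ => c1 μ _ (hmemS θ φ) (hST θ φ))).trans hfin
    exact (hwbox _ (hmem β hβ s h0 h1 θ φ)).self_of_nhds
  · rw [← partialDown_congr (huΨ β (hBC hβ)) μ, ← congrFun (hw1 μ) β]
    refine (abs_le_of_kirchhoff (hw1s μ) hS (fun s h0 h1 θ φ => ?_)
      (fun θ φ => c1 μ _ (hmemS θ φ) (hST θ φ))
      (fun θ φ ν => c2 μ ν _ (hmemS θ φ) (hST θ φ))).trans hfin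
    exact box_partialDown_eq_zero hw (hwbox _ (hmem β hβ s h0 h1 θ φ)) μ

end PlaneWaves

/-! ### Polynomial approximation with prescribed parity -/

section Parity

open Polynomial

lemma exists_derivative_eq (q : ℝ[X]) : ∃ Q : ℝ[X], derivative Q = q := by
  induction q using Polynomial.induction_on' with
  | add p q hp hq =>
    obtain ⟨P, rfl⟩ := hp
    obtain ⟨Q, rfl⟩ := hq
    exact ⟨P + Q, derivative_add⟩
  | monomial n a =>
    refine ⟨monomial (n + 1) (a / (n + 1)), ?_⟩
    rw [derivative_monomial]
    congr 1
    push_cast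
    field_simp

/-- Substitute `y = t ^ 2`: Weierstrass approximates the derivative `f' (√y) / (2 √y)` of `f (√y)`,
and a primitive of the polynomial, normalized at `a`, approximates the function. The assumption `0 <
a` keeps the quotient continuous. -/
lemma exists_even_polynomial_near {a b : ℝ} (ha : 0 < a) (hab : a ≤ b) {f f' : ℝ → ℝ}
    (hf : ∀ t ∈ Set.Icc a b, HasDerivAt f (f' t) t) (hf' : ContinuousOn f' (Set.Icc a b))
    {δ : ℝ} (hδ : 0 < δ) :
    ∃ p : ℝ[X], ∀ t ∈ Set.Icc a b, |f t - p.eval (t ^ 2)| ≤ δ ∧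
      |f' t - 2 * t * (derivative p).eval (t ^ 2)| ≤ δ := by
  have hb : 0 < b := ha.trans_le hab
  have hmaps : Set.MapsTo Real.sqrt (Set.Icc (a ^ 2) (b ^ 2)) (Set.Icc a b) := fun y hy =>
    ⟨Real.le_sqrt_of_sq_le hy.1, (Real.sqrt_le_left hb.le).2 hy.2⟩
  have hh : ContinuousOn (fun y => f' (Real.sqrt y) / (2 * Real.sqrt y))
      (Set.Icc (a ^ 2) (b ^ 2)) :=
    (hf'.comp Real.continuous_sqrt.continuousOn hmaps).div
      (continuous_const.mul Real.continuous_sqrt).continuousOn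
      fun y hy => (mul_pos two_pos (ha.trans_le (hmaps hy).1)).ne'
  -- The chain rule costs a factor `2 * b`, and integrating over an interval of length at most `b`
  -- is absorbed by `1 + b`.
  obtain ⟨q, hq⟩ := exists_polynomial_near_of_continuousOn _ _ _ hh (δ / (2 * b * (1 + b)))
    (by positivity)
  obtain ⟨Q, rfl⟩ := exists_derivative_eq q
  let p : ℝ[X] := Q + C (f a - Q.eval (a ^ 2))
  have hp' : derivative p = derivative Q := by simp [p]
  have hd : ∀ t ∈ Set.Icc a b, |f' t - 2 * t * (derivative p).eval (t ^ 2)| ≤ δ / (1 + b) := by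
    intro t ht
    have ht0 : 0 < t := ha.trans_le ht.1
    have h1 := hq (t ^ 2) ⟨pow_le_pow_left₀ ha.le ht.1 2, pow_le_pow_left₀ ht0.le ht.2 2⟩
    rw [Real.sqrt_sq ht0.le, abs_sub_comm] at h1
    rw [hp']
    have h2 : f' t - 2 * t * (derivative Q).eval (t ^ 2) =
        2 * t * (f' t / (2 * t) - (derivative Q).eval (t ^ 2)) := by
      field_simp
    rw [h2, abs_mul, abs_of_pos (by positivity)]
    calc _ ≤ 2 * b * (δ / (2 * b * (1 + b))) :=
          mul_le_mul (by linarith [ht.2]) h1.le (abs_nonneg _) (by positivity)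
      _ = δ / (1 + b) := by field_simp
  have he : ∀ t ∈ Set.Icc a b, HasDerivAt (fun t => f t - p.eval (t ^ 2))
      (f' t - 2 * t * (derivative p).eval (t ^ 2)) t := by
    intro t ht
    have h1 := (p.hasDerivAt (t ^ 2)).comp t (hasDerivAt_pow 2 t)
    refine ((hf t ht).sub h1).congr_deriv ?_
    simp
    ring
  refine ⟨p, fun t ht => ⟨?_, (hd t ht).trans ?_⟩⟩
  · have h1 := (convex_Icc a b).norm_image_sub_le_of_norm_hasDerivWithin_le
      (fun x hx => (he x hx).hasDerivWithinAt) hd (Set.left_mem_Icc.2 hab) ht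
    simp only [p, eval_add, eval_C, Real.norm_eq_abs] at h1
    simp only [p, eval_add, eval_C]
    have h2 : f a - (eval (a ^ 2) Q + (f a - eval (a ^ 2) Q)) = 0 := by ring
    rw [h2, sub_zero, abs_of_nonneg (sub_nonneg.2 ht.1)] at h1
    refine h1.trans ?_
    rw [div_mul_eq_mul_div, div_le_iff₀ (by positivity)]
    nlinarith [ht.2]
  · exact div_le_self hδ.le (by linarith)

/-- A smooth function is `C¹`-close, on a compact interval of positive numbers, to polynomials of
either parity. -/
lemma exists_polynomial_near_of_parity (j : Fin 2) {a b : ℝ} (ha : 0 < a) (hab : a ≤ b)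
    {f : ℝ → ℝ} (hf : ContDiff ℝ ∞ f) {δ : ℝ} (hδ : 0 < δ) :
    ∃ p : ℝ[X], ∀ t ∈ Set.Icc a b, |f t - (X ^ (j : ℕ) * p.comp (X ^ 2)).eval t| ≤ δ ∧
      |deriv f t - (derivative (X ^ (j : ℕ) * p.comp (X ^ 2))).eval t| ≤ δ := by
  have hb : 0 < b := ha.trans_le hab
  have hfd : ∀ t, HasDerivAt f (deriv f t) t := fun t => (hf.differentiable (by simp) t).hasDerivAt
  have hfc : Continuous (deriv f) := (contDiff_deriv_top hf).continuous
  fin_cases j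
  · obtain ⟨p, hp⟩ := exists_even_polynomial_near ha hab (fun t _ => hfd t) hfc.continuousOn hδ
    refine ⟨p, fun t ht => ?_⟩
    have := hp t ht
    simp only [pow_zero, one_mul, eval_comp, eval_pow, eval_X, derivative_comp, eval_mul,
      derivative_X_pow, eval_C]
    refine ⟨this.1, ?_⟩
    convert this.2 using 3
    simp
  -- For odd parity, approximate `f t / t` by an even polynomial and multiply by `t`. The product
  -- rule turns an error `η` into `η + b * η`, which explains `δ / (1 + b)`.
  · have h0 : ∀ t ∈ Set.Icc a b, t ≠ 0 := fun t ht => (ha.trans_le ht.1).ne'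
    have hF : ∀ t ∈ Set.Icc a b, HasDerivAt (fun t => f t / t)
        ((deriv f t * t - f t * 1) / t ^ 2) t := fun t ht =>
      (hfd t).div (hasDerivAt_id t) (h0 t ht)
    obtain ⟨p, hp⟩ := exists_even_polynomial_near ha hab hF
      (((hfc.mul continuous_id).sub (hf.continuous.mul continuous_const)).continuousOn.div
        (continuous_pow 2).continuousOn fun t ht => pow_ne_zero 2 (h0 t ht))
      (δ := δ / (1 + b)) (by positivity)
    refine ⟨p, fun t ht => ?_⟩
    obtain ⟨h1, h2⟩ := hp t ht
    have ht0 : 0 < t := ha.trans_le ht.1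
    have hbt : t * (δ / (1 + b)) ≤ b * (δ / (1 + b)) :=
      mul_le_mul_of_nonneg_right ht.2 (by positivity)
    have hsum : δ / (1 + b) + b * (δ / (1 + b)) = δ := by field_simp
    have hpos : 0 < δ / (1 + b) := by positivity
    simp only [pow_one, eval_comp, eval_pow, eval_X,
      derivative_comp, eval_mul, derivative_X_pow, eval_C, derivative_mul, derivative_X, eval_add,
      eval_one]
    constructor
    · have e : f t - t * eval (t ^ 2) p = t * (f t / t - eval (t ^ 2) p) := by field_simp
      rw [e, abs_mul, abs_of_pos ht0]
      nlinarith [mul_le_mul_of_nonneg_left h1 ht0.le]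
    · have e : deriv f t - (1 * eval (t ^ 2) p +
          t * ((((2 : ℕ) : ℝ) * t ^ (2 - 1)) * eval (t ^ 2) (derivative p))) =
          (f t / t - eval (t ^ 2) p) + t * ((deriv f t * t - f t * 1) / t ^ 2 -
            2 * t * eval (t ^ 2) (derivative p)) := by
        push_cast
        field_simp
        ring
      rw [e]
      refine (abs_add_le _ _).trans ?_
      rw [abs_mul, abs_of_pos ht0]
      nlinarith [mul_le_mul_of_nonneg_left h2 ht0.le]

end Parity

/-! ### Derivatives of `1 / β²` -/

section DerivSpan

/-- The derivatives `∂^{μ₁} ⋯ ∂^{μₘ} (β²)⁻¹`. -/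
def derivInvSq (μs : List (Fin 4)) : Minkowski → ℝ := multiPartialUp μs fun b => (sq b)⁻¹

/-- The span of the derivatives of `(β²)⁻¹` whose orders belong to `S`. -/
def derivSpan (S : Set ℕ) : Submodule ℝ (Minkowski → ℝ) :=
  Submodule.span ℝ (derivInvSq '' {μs | μs.length ∈ S})

lemma contDiffAt_derivInvSq (μs : List (Fin 4)) {β : Minkowski} (hβ : β ∈ forwardCone) :
    ContDiffAt ℝ ∞ (derivInvSq μs) β := by
  induction μs with
  | nil => exact contDiff_sq.contDiffAt.inv hβ.2.ne'
  | cons μ μs ih => exact (contDiffAt_partialDown ih μ).const_smul (eta μ)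

lemma contDiffAt_of_mem_derivSpan {S : Set ℕ} {f : Minkowski → ℝ} (hf : f ∈ derivSpan S)
    {β : Minkowski} (hβ : β ∈ forwardCone) : ContDiffAt ℝ ∞ f β := by
  induction hf using Submodule.span_induction with
  | mem f h =>
    obtain ⟨μs, -, rfl⟩ := h
    exact contDiffAt_derivInvSq μs hβ
  | zero => exact contDiffAt_const
  | add f g _ _ hf hg => exact hf.add hg
  | smul c f _ hf => exact hf.const_smul c

/-- Equality is asked only on the cone, where members of the span are known to be differentiable and
the derivative is therefore linear. -/
lemma exists_partialUp_mem_derivSpan {k : ℕ} {f : Minkowski → ℝ} (hf : f ∈ derivSpan {k})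
    (μ : Fin 4) : ∃ g ∈ derivSpan {k + 1}, ∀ β ∈ forwardCone, partialUp μ f β = g β := by
  induction hf using Submodule.span_induction with
  | mem f h =>
    obtain ⟨μs, hμs, rfl⟩ := h
    refine ⟨derivInvSq (μ :: μs), Submodule.subset_span ⟨μ :: μs, ?_, rfl⟩, fun β _ => rfl⟩
    simpa using hμs
  | zero =>
    refine ⟨0, Submodule.zero_mem _, fun β _ => ?_⟩
    have : partialDown μ (fun _ : Minkowski => (0 : ℝ)) β = 0 := by simp [partialDown]
    change eta μ • partialDown μ (fun _ : Minkowski => (0 : ℝ)) β = 0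
    rw [this, smul_zero]
  | add f g hfm hgm hf hg =>
    obtain ⟨f', hf', h1⟩ := hf
    obtain ⟨g', hg', h2⟩ := hg
    refine ⟨f' + g', Submodule.add_mem _ hf' hg', fun β hβ => ?_⟩
    rw [Pi.add_apply, ← h1 β hβ, ← h2 β hβ]
    change eta μ • partialDown μ (fun b => f b + g b) β = _
    rw [partialDown_add ((contDiffAt_of_mem_derivSpan hfm hβ).differentiableAt (by simp))
      ((contDiffAt_of_mem_derivSpan hgm hβ).differentiableAt (by simp)), smul_add]
    rfl
  | smul c f hfm hf =>
    obtain ⟨f', hf', h1⟩ := hf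
    refine ⟨c • f', Submodule.smul_mem _ _ hf', fun β hβ => ?_⟩
    rw [Pi.smul_apply, ← h1 β hβ]
    change eta μ • partialDown μ (fun b => c * f b) β = _
    rw [partialDown_const_mul
      ((contDiffAt_of_mem_derivSpan hfm hβ).differentiableAt (by simp)), partialUp]
    simp only [smul_eq_mul]
    ring

lemma partialDown_pow {f : Minkowski → ℝ} {β : Minkowski} (hf : DifferentiableAt ℝ f β) (k : ℕ)
    (μ : Fin 4) :
    partialDown μ (fun b => f b ^ k) β = k * f β ^ (k - 1) * partialDown μ f β := by
  have := hf.hasFDerivAt.pow k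
  rw [partialDown, this.fderiv, partialDown]
  simp

/-- For null `n`, the Kelvin transform of `(n · β)^k` is a combination of derivatives of order `k`
of `(β²)⁻¹`. -/
lemma exists_mem_derivSpan_eq_pow {n : Minkowski} (hn : sq n = 0) (k : ℕ) :
    ∃ g ∈ derivSpan {k}, ∀ β ∈ forwardCone, mdot n β ^ k * (sq β)⁻¹ ^ (k + 1) = g β := by
  induction k with
  | zero =>
    exact ⟨derivInvSq [], Submodule.subset_span ⟨[], by simp, rfl⟩, fun β _ => by
      simp [derivInvSq, multiPartialUp]⟩
  | succ k ih =>
    obtain ⟨g, hg, h⟩ := ih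
    choose G hG hGg using exists_partialUp_mem_derivSpan hg
    -- Apply `n · ∂` to the case `k`. Acting on the power of `(sq β)⁻¹` it gives `-2 (k + 1)` times
    -- the next case; acting on `mdot n β ^ k` it gives a multiple of `sq n = 0`.
    refine ⟨(-(2 * (k + 1 : ℝ)))⁻¹ • ∑ μ, (eta μ * n μ) • G μ,
      Submodule.smul_mem _ _ (Submodule.sum_mem _ fun μ _ => Submodule.smul_mem _ _ (hG μ)),
      fun β hβ => ?_⟩
    have hq := hβ.2
    have hm : DifferentiableAt ℝ (mdot n) β :=
      (contDiff_mdot (n := 1) n).differentiable (by simp) β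
    have hs : DifferentiableAt ℝ (fun b => (sq b)⁻¹) β :=
      (contDiff_sq.contDiffAt.inv hq.ne' : ContDiffAt ℝ 1 _ β).differentiableAt (by simp)
    have hval : ∀ μ, G μ β = eta μ * (mdot n β ^ k * ((k + 1 : ℕ) * (sq β)⁻¹ ^ k *
        (-(2 * eta μ * β μ) / sq β ^ 2)) +
        k * mdot n β ^ (k - 1) * (eta μ * n μ) * (sq β)⁻¹ ^ (k + 1)) := by
      intro μ
      rw [← hGg μ β hβ, partialUp, smul_eq_mul]
      congr 1
      have : g =ᶠ[nhds β] fun b => mdot n b ^ k * (sq b)⁻¹ ^ (k + 1) := by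
        filter_upwards [isOpen_forwardCone.mem_nhds hβ] with b hb
        exact (h b hb).symm
      rw [partialDown_congr this, partialDown_mul (hm.fun_pow k) (hs.fun_pow (k + 1)),
        partialDown_pow hm, partialDown_pow hs, partialDown_inv_sq hq.ne', partialDown_mdot,
        Nat.add_sub_cancel]
    have hsum : ∑ μ, eta μ * n μ * G μ β =
        -(2 * (k + 1 : ℝ)) * (mdot n β ^ k * (sq β)⁻¹ ^ (k + 2)) * mdot n β +
        k * mdot n β ^ (k - 1) * (sq β)⁻¹ ^ (k + 1) * sq n := by
      change _ = -(2 * (k + 1 : ℝ)) * (mdot n β ^ k * (sq β)⁻¹ ^ (k + 2)) *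
        (∑ μ, eta μ * n μ * β μ) +
        k * mdot n β ^ (k - 1) * (sq β)⁻¹ ^ (k + 1) * ∑ μ, eta μ * n μ ^ 2
      rw [Finset.mul_sum, Finset.mul_sum, ← Finset.sum_add_distrib]
      refine Finset.sum_congr rfl fun μ _ => ?_
      rw [hval]
      push_cast
      linear_combination (-(2 * (k + 1 : ℝ)) * (mdot n β ^ k * (sq β)⁻¹ ^ (k + 2)) *
        (eta μ * n μ * β μ) + k * mdot n β ^ (k - 1) * (sq β)⁻¹ ^ (k + 1) *
        (eta μ * n μ ^ 2)) * eta_mul_self μ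
    rw [hn, mul_zero, add_zero] at hsum
    simp only [Pi.smul_apply, Finset.sum_apply, smul_eq_mul]
    have : (k + 1 : ℝ) ≠ 0 := by positivity
    rw [hsum, eq_inv_mul_iff_mul_eq₀ (neg_ne_zero.2 (mul_ne_zero two_ne_zero this))]
    ring

end DerivSpan

/-! ### Approximation of solutions by derivatives of `1 / β²` -/

section Approximation

lemma derivSpan_mono {S T : Set ℕ} (h : S ⊆ T) : derivSpan S ≤ derivSpan T :=
  Submodule.span_mono (Set.image_mono fun _ hμs => h hμs)

lemma mdot_inversion (n β : Minkowski) : mdot n (inversion β) = (sq β)⁻¹ * mdot n β := by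
  simp only [mdot_eq, inversion, Pi.smul_apply, smul_eq_mul]; ring

/-- The natural numbers of parity `j`. -/
def ofParity (j : Fin 2) : Set ℕ := {m | m % 2 = j}

open Polynomial in
-- Inversion divides `n · β` by `β²`, so the monomial of degree `m` becomes `(n · β) ^ m / (β²) ^ (m
-- + 1)`, a combination of derivatives of order exactly `m`. Parity of degrees becomes parity of
-- orders.
lemma exists_kelvin_eq_of_parity {n : Minkowski} (hn : IsFutureNull n) (j : Fin 2) (p : ℝ[X]) :
    ∃ h ∈ derivSpan (ofParity j), ∀ β ∈ forwardCone,
      kelvin (fun b => (X ^ (j : ℕ) * p.comp (X ^ 2)).eval (mdot n b)) β = h β := by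
  choose g hg hgk using exists_mem_derivSpan_eq_pow hn.2
  refine ⟨∑ i ∈ p.support, p.coeff i • g (2 * i + j),
    Submodule.sum_mem _ fun i _ => Submodule.smul_mem _ _ (derivSpan_mono ?_ (hg _)),
    fun β hβ => ?_⟩
  · rintro _ rfl
    change (2 * i + j) % 2 = _
    have := j.2
    omega
  · simp only [Finset.sum_apply, Pi.smul_apply, smul_eq_mul]
    rw [kelvin, mdot_inversion, eval_mul, eval_pow, eval_X, eval_comp, eval_pow, eval_X,
      eval_eq_sum, Polynomial.sum, Finset.mul_sum, Finset.mul_sum]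
    refine Finset.sum_congr rfl fun i _ => ?_
    rw [← hgk _ β hβ]
    ring

open Polynomial in
/-- On compact sets, sums of plane waves are `C¹`-limits of functions whose Kelvin transforms are
combinations of derivatives of `(β²)⁻¹` of the given parity. -/
lemma exists_near_planeWaves {P : Minkowski → ℝ} (hP : P ∈ planeWaves) (j : Fin 2)
    {K : Set Minkowski} (hK : IsCompact K) (hKV : K ⊆ forwardCone) {δ : ℝ} (hδ : 0 < δ) :
    ∃ g : Minkowski → ℝ, ContDiff ℝ ∞ g ∧
      (∃ h ∈ derivSpan (ofParity j), ∀ β ∈ forwardCone, kelvin g β = h β) ∧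
      ∀ x ∈ K, |P x - g x| ≤ δ ∧ ∀ μ, |partialDown μ P x - partialDown μ g x| ≤ δ := by
  induction hP using Submodule.span_induction generalizing δ with
  | mem P h =>
    obtain ⟨n, f, hn, hf, rfl⟩ := h
    rcases K.eq_empty_or_nonempty with rfl | hne
    · exact ⟨0, contDiff_const, ⟨0, Submodule.zero_mem _, fun β _ => by simp [kelvin]⟩,
        fun x hx => hx.elim⟩
    have hmc : Continuous (mdot n) := (contDiff_mdot (n := 0) n).continuous
    obtain ⟨x₀, hx₀, hmin⟩ := hK.exists_isMinOn hne hmc.continuousOn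
    obtain ⟨x₁, hx₁, hmax⟩ := hK.exists_isMaxOn hne hmc.continuousOn
    -- The relevant interval is the range of `n · β` over `K`, bounded away from 0. Differentiation
    -- brings out a factor `n μ`, which `1 + ‖n‖` compensates.
    obtain ⟨p, hp⟩ := exists_polynomial_near_of_parity j (mdot_pos hn (hKV hx₀)) (hmin hx₁) hf
      (δ := δ / (1 + ‖n‖)) (by positivity)
    set G : ℝ[X] := X ^ (j : ℕ) * p.comp (X ^ 2)
    have hG : ContDiff ℝ ∞ fun t => G.eval t := by
      simpa only [Polynomial.coe_aeval_eq_eval] using G.contDiff_aeval (𝕜 := ℝ) ∞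
    refine ⟨fun b => G.eval (mdot n b), hG.comp (contDiff_mdot n),
      exists_kelvin_eq_of_parity hn j p, fun x hx => ?_⟩
    obtain ⟨h1, h2⟩ := hp (mdot n x) ⟨hmin hx, hmax hx⟩
    refine ⟨h1.trans (div_le_self hδ.le (by linarith [norm_nonneg n])), fun μ => ?_⟩
    rw [partialDown_comp_mdot (hf.differentiable (by simp) _),
      partialDown_comp_mdot (hG.differentiable (by simp) _), Polynomial.deriv, ← sub_mul, abs_mul,
      abs_mul, abs_eta, one_mul]
    have hnμ : |n μ| ≤ 1 + ‖n‖ := (norm_le_pi_norm n μ).trans (by linarith)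
    calc _ ≤ δ / (1 + ‖n‖) * (1 + ‖n‖) := mul_le_mul h2 hnμ (abs_nonneg _) (by positivity)
      _ = δ := div_mul_cancel₀ _ (by positivity)
  | zero =>
    refine ⟨0, contDiff_const, ⟨0, Submodule.zero_mem _, fun β _ => by simp [kelvin]⟩,
      fun x _ => ?_⟩
    simp [hδ.le]
  | add P Q hPm hQm hP hQ =>
    obtain ⟨g, hg, ⟨h, hh, hgh⟩, hPg⟩ := hP (half_pos hδ)
    obtain ⟨g', hg', ⟨h', hh', hgh'⟩, hQg⟩ := hQ (half_pos hδ)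
    have hPs := (contDiff_and_box_of_mem_planeWaves hPm).1
    have hQs := (contDiff_and_box_of_mem_planeWaves hQm).1
    refine ⟨fun b => g b + g' b, hg.add hg', ⟨h + h', Submodule.add_mem _ hh hh', fun β hβ => ?_⟩,
      fun x hx => ⟨?_, fun μ => ?_⟩⟩
    · rw [Pi.add_apply, ← hgh β hβ, ← hgh' β hβ]
      simp only [kelvin]; ring
    · have h1 := abs_add_le (P x - g x) (Q x - g' x)
      rw [Pi.add_apply, show P x + Q x - (g x + g' x) = P x - g x + (Q x - g' x) by ring]
      linarith [(hPg x hx).1, (hQg x hx).1]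
    · change |partialDown μ (fun b => P b + Q b) x - _| ≤ δ
      rw [partialDown_add (hPs.differentiable (by simp) x) (hQs.differentiable (by simp) x),
        partialDown_add (hg.differentiable (by simp) x) (hg'.differentiable (by simp) x),
        add_sub_add_comm]
      refine (abs_add_le _ _).trans ?_
      linarith [(hPg x hx).2 μ, (hQg x hx).2 μ]
  | smul c P hPm hP =>
    obtain ⟨g, hg, ⟨h, hh, hgh⟩, hPg⟩ := hP (δ := δ / (1 + |c|)) (by positivity)
    have hPs := (contDiff_and_box_of_mem_planeWaves hPm).1
    have hc : ∀ {y : ℝ}, |y| ≤ δ / (1 + |c|) → |c * y| ≤ δ := fun {y} hy => by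
      rw [abs_mul]
      calc _ ≤ (1 + |c|) * (δ / (1 + |c|)) :=
            mul_le_mul (by linarith) hy (abs_nonneg _) (by positivity)
        _ = δ := mul_div_cancel₀ _ (by positivity)
    refine ⟨fun b => c * g b, contDiff_const.mul hg, ⟨c • h, Submodule.smul_mem _ _ hh,
      fun β hβ => ?_⟩, fun x hx => ⟨?_, fun μ => ?_⟩⟩
    · rw [Pi.smul_apply, ← hgh β hβ, smul_eq_mul]
      simp only [kelvin]; ring
    · rw [Pi.smul_apply, smul_eq_mul, ← mul_sub]
      exact hc (hPg x hx).1
    · change |partialDown μ (fun b => c * P b) x - _| ≤ δ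
      rw [partialDown_const_mul (hPs.differentiable (by simp) x),
        partialDown_const_mul (hg.differentiable (by simp) x), ← mul_sub]
      exact hc ((hPg x hx).2 μ)

/-- On a compact subset of the forward cone, every real smooth solution of the wave equation is a
`C¹`-limit of combinations of derivatives of `(β²)⁻¹` of even order, and also of odd order. -/
theorem exists_derivSpan_near {Ξ : Minkowski → ℝ} (hΞ : IsSmoothWaveSolution Ξ)
    {B : Set Minkowski} (hB : IsCompact B) (hBV : B ⊆ forwardCone) (j : Fin 2) {ε : ℝ}
    (hε : 0 < ε) :
    ∃ h ∈ derivSpan (ofParity j), ∀ β ∈ B, |Ξ β - h β| ≤ ε ∧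
      ∀ μ, |partialDown μ Ξ β - partialDown μ h β| ≤ ε := by
  obtain ⟨C, hC, hbound⟩ := exists_kelvin_bound hB hBV
  have hδ : 0 < ε / (2 * C) := by positivity
  have hK : IsCompact (inversion '' B) := hB.image_of_continuousOn fun β hβ =>
    (contDiffAt_inversion (n := 0) (hBV hβ).2.ne').continuousAt.continuousWithinAt
  have hKV : inversion '' B ⊆ forwardCone := by
    rintro _ ⟨β, hβ, rfl⟩
    exact inversion_mem (hBV hβ)
  -- Approximate the transform of `Ξ` on the inverted compact set and transform back. The two errors
  -- `ε / (2 * C)` add up to `ε / C`, and the way back costs the factor `C`.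
  obtain ⟨P, hP, hPΨ⟩ := exists_planeWaves_near hΞ.kelvin hK hKV hδ
  obtain ⟨g, hg, ⟨h, hh, hgh⟩, hPg⟩ := exists_near_planeWaves hP j hK hKV hδ
  refine ⟨h, hh, fun β hβ => ?_⟩
  let D : Minkowski → ℝ := fun b => kelvin Ξ b - g b
  have hβV := hBV hβ
  have hyV := inversion_mem hβV
  have hΨd := (hΞ.kelvin.contDiffAt hyV).differentiableAt (by simp)
  have hgd : ∀ x, DifferentiableAt ℝ g x := hg.differentiable (by simp)
  have hsplit : ∀ {x y z : ℝ}, |x - y| ≤ ε / (2 * C) → |y - z| ≤ ε / (2 * C) →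
      |x - z| ≤ ε / C := fun {x y z} h1 h2 => by
    have h3 := abs_sub_le x y z
    have h4 : ε / (2 * C) + ε / (2 * C) = ε / C := by field_simp; ring
    linarith
  have h1 := hPΨ _ ⟨β, hβ, rfl⟩
  have h2 := hPg _ ⟨β, hβ, rfl⟩
  obtain ⟨k0, k1⟩ := hbound D β hβ (ε / C) (hΨd.fun_sub (hgd _)) (hsplit h1.1 h2.1) fun μ => by
    rw [partialDown_sub hΨd (hgd _)]
    exact hsplit (h1.2 μ) (h2.2 μ)
  rw [mul_div_cancel₀ _ hC.ne'] at k0 k1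
  have hD : ∀ b ∈ forwardCone, kelvin D b = Ξ b - h b := fun b hb => by
    rw [← kelvin_kelvin Ξ hb.2.ne', ← hgh b hb]
    simp only [kelvin, D]
    ring
  refine ⟨by rwa [← hD β hβV], fun μ => ?_⟩
  rw [← partialDown_sub ((hΞ.contDiffAt hβV).differentiableAt (by simp))
    ((contDiffAt_of_mem_derivSpan hh hβV).differentiableAt (by simp))]
  have : (fun b => Ξ b - h b) =ᶠ[nhds β] kelvin D := by
    filter_upwards [isOpen_forwardCone.mem_nhds hβV] with b hb
    exact (hD b hb).symm
  rw [partialDown_congr this]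
  exact k1 μ

end Approximation

/-! ### Thermal functions -/

section ThermalFunctions

/-- Euler's formula makes `ζ (m + 2)` a multiple of this Bernoulli number, and a sum of nonnegative
terms whose term at 1 equals 1 cannot vanish. -/
lemma bernoulli_ne_zero_of_even {m : ℕ} (hm : Even m) : bernoulli (m + 2) ≠ 0 := by
  obtain ⟨k, rfl⟩ := hm
  intro h0
  have h := hasSum_zeta_nat (k := k + 1) (Nat.succ_ne_zero k)
  rw [show 2 * (k + 1) = k + k + 2 by ring, h0] at h
  simp only [Rat.cast_zero, mul_zero, zero_div] at h
  have h1 := (hasSum_zero_iff_of_nonneg fun n => by positivity).1 h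
  have h2 := congrFun h1 1
  simp at h2

lemma thermalConst_ne_zero {m : ℕ} (hm : Even m) : thermalConst m ≠ 0 := by
  have h := bernoulli_ne_zero_of_even hm
  rw [thermalConst, if_pos hm]
  have hf : ((m + 2).factorial : ℝ) ≠ 0 := by positivity
  have hb : |(bernoulli (m + 2) : ℝ)| ≠ 0 := by simpa using h
  have hp : (4 * Real.pi) ^ m ≠ 0 := pow_ne_zero _ (by positivity)
  have hs : (-1 : ℝ) ^ (m / 2) ≠ 0 := pow_ne_zero _ (by norm_num)
  exact mul_ne_zero (mul_ne_zero (mul_ne_zero hs hp) (inv_ne_zero hf)) hb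

lemma exists_finsupp_of_mem_derivSpan {S : Set ℕ} {h : Minkowski → ℝ} (hh : h ∈ derivSpan S) :
    ∃ c : List (Fin 4) →₀ ℝ, (∀ μs ∈ c.support, μs.length ∈ S) ∧
      h = fun β => ∑ μs ∈ c.support, c μs * derivInvSq μs β := by
  obtain ⟨c, hc, rfl⟩ := (Finsupp.mem_span_image_iff_linearCombination ℝ).1 hh
  refine ⟨c, fun μs hμs => (Finsupp.mem_supported ℝ c).1 hc hμs, ?_⟩
  ext β
  simp [Finsupp.linearCombination_apply, Finsupp.sum]

/-- Division of the coefficients of a finitely supported family by nonzero scalars. -/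
lemma exists_finsupp_div (c : List (Fin 4) →₀ ℝ) (k : List (Fin 4) → ℝ)
    (hk : ∀ μs ∈ c.support, k μs ≠ 0) :
    ∃ d : List (Fin 4) →₀ ℝ, ∀ t : List (Fin 4) → ℝ,
      ∑ μs ∈ d.support, d μs * (k μs * t μs) = ∑ μs ∈ c.support, c μs * t μs := by
  refine ⟨Finsupp.onFinset c.support (fun μs => c μs / k μs) fun μs h => ?_, fun t => ?_⟩
  · rw [Finsupp.mem_support_iff]
    exact fun h0 => h (by rw [h0, zero_div])
  · have h1 := Finsupp.onFinset_sum (g := fun μs w => w * (k μs * t μs)) (s := c.support)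
      (f := fun μs => c μs / k μs)
      (fun μs h => Finsupp.mem_support_iff.2 fun h0 => h (by rw [h0, zero_div]))
      (fun _ => zero_mul _)
    refine h1.trans (Finset.sum_congr rfl fun μs hμs => ?_)
    have := hk μs hμs
    field_simp

lemma exists_thermalFun_eq {h : Minkowski → ℝ} (hh : h ∈ derivSpan (ofParity 0)) :
    ∃ d : List (Fin 4) →₀ ℝ, ∀ β, ∑ μs ∈ d.support, d μs * thermalFun μs β = h β := by
  obtain ⟨c, hc, rfl⟩ := exists_finsupp_of_mem_derivSpan hh
  obtain ⟨d, hd⟩ := exists_finsupp_div c (fun μs => thermalConst μs.length) fun μs hμs =>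
    thermalConst_ne_zero (Nat.even_iff.2 (hc μs hμs))
  exact ⟨d, fun β => hd fun μs => derivInvSq μs β⟩

/-- Here odd orders are needed: prepending `ν` makes the length even, so the constant is nonzero. It
depends on the length alone, so a single `d` serves all `ν`. -/
lemma exists_thermalFun_cons_eq {h : Minkowski → ℝ} (hh : h ∈ derivSpan (ofParity 1)) :
    ∃ d : List (Fin 4) →₀ ℝ, ∀ ν, ∀ β ∈ forwardCone,
      ∑ μs ∈ d.support, d μs * thermalFun (ν :: μs) β = partialUp ν h β := by
  obtain ⟨c, hc, rfl⟩ := exists_finsupp_of_mem_derivSpan hh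
  obtain ⟨d, hd⟩ := exists_finsupp_div c (fun μs => thermalConst (μs.length + 1)) fun μs hμs =>
    thermalConst_ne_zero (Nat.even_add_one.2 (Nat.not_even_iff.2 (hc μs hμs)))
  refine ⟨d, fun ν β hβ => ?_⟩
  have hdiff : ∀ μs, DifferentiableAt ℝ (derivInvSq μs) β := fun μs =>
    (contDiffAt_derivInvSq μs hβ).differentiableAt (by simp)
  rw [partialUp, partialDown_sum _ fun μs _ => (hdiff μs).const_mul _]
  simp_rw [partialDown_const_mul (hdiff _)]
  rw [smul_eq_mul, Finset.mul_sum]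
  refine (hd fun μs => derivInvSq (ν :: μs) β).trans (Finset.sum_congr rfl fun μs _ => ?_)
  change c μs * (eta ν * partialDown ν (derivInvSq μs) β) = _
  ring

end ThermalFunctions

/-! ### Real and imaginary parts -/

section Components

variable {F G : Type*} [NormedAddCommGroup F] [NormedSpace ℝ F] [NormedAddCommGroup G]
  [NormedSpace ℝ G]

lemma partialDown_clm_comp (L : F →L[ℝ] G) {f : Minkowski → F} {β : Minkowski}
    (hf : DifferentiableAt ℝ f β) (μ : Fin 4) :
    partialDown μ (fun b => L (f b)) β = L (partialDown μ f β) := by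
  have := L.hasFDerivAt.comp β hf.hasFDerivAt
  rw [partialDown]
  change (fderiv ℝ (L ∘ f) β) _ = _
  rw [this.fderiv]
  rfl

lemma IsSmoothWaveSolution.clm_comp {f : Minkowski → F} (hf : IsSmoothWaveSolution f)
    (L : F →L[ℝ] G) : IsSmoothWaveSolution fun b => L (f b) := by
  have hs : ∀ β ∈ forwardCone, ContDiffAt ℝ ∞ (fun b => L (f b)) β := fun β hβ =>
    L.contDiff.contDiffAt.comp β (hf.contDiffAt hβ)
  refine ⟨fun β hβ => (hs β hβ).contDiffWithinAt, fun β hβ => ?_⟩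
  have h2 : ∀ μ, partialDown μ (partialDown μ fun b => L (f b)) β =
      L (partialDown μ (partialDown μ f) β) := fun μ => by
    rw [← partialDown_clm_comp L
      ((contDiffAt_partialDown (hf.contDiffAt hβ) μ).differentiableAt (by simp))]
    refine partialDown_congr ?_ μ
    filter_upwards [isOpen_forwardCone.mem_nhds hβ] with b hb
    exact partialDown_clm_comp L ((hf.contDiffAt hb).differentiableAt (by simp)) μ
  have h := hf.wave β hβ
  rw [box_eq_sum (hf.contDiffAt hβ)] at h
  rw [box_eq_sum (hs β hβ)]
  simp_rw [h2, ← map_smul]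
  rw [← map_sum, h, map_zero]

variable {𝕜 : Type*} [RCLike 𝕜]

/-- Covers the real and the complex case at once: when `𝕜` is real, `RCLike.I` is zero and the
second family drops out. -/
lemma exists_finsupp_complex (a b : List (Fin 4) →₀ ℝ) :
    ∃ c : List (Fin 4) →₀ 𝕜, ∀ t : List (Fin 4) → ℝ,
      ∑ μs ∈ c.support, c μs * (t μs : 𝕜) =
        ((∑ μs ∈ a.support, a μs * t μs : ℝ) : 𝕜) +
        ((∑ μs ∈ b.support, b μs * t μs : ℝ) : 𝕜) * RCLike.I := by
  have hmap : ∀ (a : List (Fin 4) →₀ ℝ) (t : List (Fin 4) → ℝ),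
      Finsupp.linearCombination 𝕜 (fun μs => (t μs : 𝕜))
        (a.mapRange (fun x : ℝ => (x : 𝕜)) RCLike.ofReal_zero) =
      ((∑ μs ∈ a.support, a μs * t μs : ℝ) : 𝕜) := fun a t => by
    rw [Finsupp.linearCombination_apply, Finsupp.sum_mapRange_index (by simp), Finsupp.sum]
    push_cast
    rfl
  refine ⟨a.mapRange (fun x : ℝ => (x : 𝕜)) RCLike.ofReal_zero +
    (RCLike.I : 𝕜) • b.mapRange (fun x : ℝ => (x : 𝕜)) RCLike.ofReal_zero, fun t => ?_⟩
  rw [← hmap a t, ← hmap b t, mul_comm _ (RCLike.I : 𝕜), ← smul_eq_mul (RCLike.I : 𝕜), ← map_smul,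
    ← map_add, Finsupp.linearCombination_apply, Finsupp.sum]
  rfl

lemma norm_sub_le_of_re_im {z : 𝕜} {x y δ : ℝ} (hx : |RCLike.re z - x| ≤ δ)
    (hy : |RCLike.im z - y| ≤ δ) : ‖z - ((x : 𝕜) + (y : 𝕜) * RCLike.I)‖ ≤ 2 * δ := by
  have h : z - ((x : 𝕜) + (y : 𝕜) * RCLike.I) =
      ((RCLike.re z - x : ℝ) : 𝕜) + ((RCLike.im z - y : ℝ) : 𝕜) * RCLike.I := by
    conv_lhs => rw [← RCLike.re_add_im z]
    push_cast
    ring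
  have hI : ‖(RCLike.I : 𝕜)‖ ≤ 1 := by
    by_cases h0 : (RCLike.I : 𝕜) = 0
    · simp [h0]
    · exact (RCLike.norm_I_of_ne_zero h0).le
  rw [h]
  refine (norm_add_le _ _).trans ?_
  rw [norm_mul, RCLike.norm_ofReal, RCLike.norm_ofReal]
  nlinarith [mul_le_mul_of_nonneg_left hI (abs_nonneg (RCLike.im z - y))]

end Components

lemma seminormOn_lt {F : Type*} [NormedAddCommGroup F] {B : Set Minkowski} {Φ : Minkowski → F} {ε : ℝ} (hε : 0 < ε)
    (h : ∀ β ∈ B, ‖Φ β‖ ≤ ε / 2) : seminormOn B Φ < ENNReal.ofReal ε := by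
  refine lt_of_le_of_lt (iSup₂_le fun β hβ => ?_)
    ((ENNReal.ofReal_lt_ofReal_iff hε).2 (half_lt_self hε))
  rw [← ofReal_norm]
  exact ENNReal.ofReal_le_ofReal (h β hβ)

end Thermal
end

/-! ### Conclusion: assembling real and imaginary parts in both parities. -/

theorem lemma3p1 {𝕜 : Type*} [RCLike 𝕜] (Ξ : Thermal.Minkowski → 𝕜)
    (hΞ : Thermal.IsSmoothWaveSolution Ξ)
    (B : Set Thermal.Minkowski) (hB : IsCompact B) (hBV : B ⊆ Thermal.forwardCone)
    (ε : ℝ) (hε : 0 < ε) :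
    ∃ c c' : List (Fin 4) →₀ 𝕜,
      Thermal.seminormOn B
          (fun β => Ξ β - ∑ μs ∈ c.support, c μs * (Thermal.thermalFun μs β : 𝕜))
        < ENNReal.ofReal ε ∧
      ∀ ν : Fin 4,
        Thermal.seminormOn B
            (fun β => Thermal.partialUp ν Ξ β -
              ∑ μs ∈ c'.support, c' μs * (Thermal.thermalFun (ν :: μs) β : 𝕜))
          < ENNReal.ofReal ε := by
  open Thermal in
  have hre : IsSmoothWaveSolution fun b => RCLike.re (Ξ b) := hΞ.clm_comp RCLike.reCLM
  have him : IsSmoothWaveSolution fun b => RCLike.im (Ξ b) := hΞ.clm_comp RCLike.imCLM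
  -- Real and imaginary errors together give `ε / 2`, which leaves room for a strict inequality
  -- after taking the supremum.
  have hε4 : 0 < ε / 4 := by positivity
  obtain ⟨f₀, hf₀, hΞf₀⟩ := exists_derivSpan_near hre hB hBV 0 hε4
  obtain ⟨g₀, hg₀, hΞg₀⟩ := exists_derivSpan_near him hB hBV 0 hε4
  obtain ⟨f₁, hf₁, hΞf₁⟩ := exists_derivSpan_near hre hB hBV 1 hε4
  obtain ⟨g₁, hg₁, hΞg₁⟩ := exists_derivSpan_near him hB hBV 1 hε4
  obtain ⟨a₀, ha₀⟩ := exists_thermalFun_eq hf₀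
  obtain ⟨b₀, hb₀⟩ := exists_thermalFun_eq hg₀
  obtain ⟨a₁, ha₁⟩ := exists_thermalFun_cons_eq hf₁
  obtain ⟨b₁, hb₁⟩ := exists_thermalFun_cons_eq hg₁
  obtain ⟨c, hc⟩ := exists_finsupp_complex (𝕜 := 𝕜) a₀ b₀
  obtain ⟨c', hc'⟩ := exists_finsupp_complex (𝕜 := 𝕜) a₁ b₁
  have hε2 : ε / 2 = 2 * (ε / 4) := by ring
  refine ⟨c, c', seminormOn_lt hε fun β hβ => ?_, fun ν => seminormOn_lt hε fun β hβ => ?_⟩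
  · rw [hc fun μs => thermalFun μs β, ha₀, hb₀, hε2]
    exact norm_sub_le_of_re_im (hΞf₀ β hβ).1 (hΞg₀ β hβ).1
  · have hd : DifferentiableAt ℝ Ξ β := (hΞ.contDiffAt (hBV hβ)).differentiableAt (by simp)
    rw [hc' fun μs => thermalFun (ν :: μs) β, ha₁ ν β (hBV hβ), hb₁ ν β (hBV hβ), hε2]
    refine norm_sub_le_of_re_im ?_ ?_
    · have h1 := (hΞf₁ β hβ).2 ν
      have h2 := partialDown_clm_comp RCLike.reCLM hd ν
      simp only [RCLike.reCLM_apply] at h2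
      rw [h2] at h1
      rw [partialUp, partialUp, RCLike.smul_re, smul_eq_mul, ← mul_sub, abs_mul, abs_eta, one_mul]
      exact h1
    · have h1 := (hΞg₁ β hβ).2 ν
      have h2 := partialDown_clm_comp RCLike.imCLM hd ν
      simp only [RCLike.imCLM_apply] at h2
      rw [h2] at h1
      rw [partialUp, partialUp, RCLike.smul_im, smul_eq_mul, ← mul_sub, abs_mul, abs_eta, one_mul]
      exact h1
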